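/- Let $N\ge 5$ and $p>\frac{N}{N-4}$, and let $Z\subset\mathbb{R}^N$ satisfy one of the following: (a) $Z$ is a compact subset of the hyperplane $\{x_1=0\}$ whose upper Minkowski dimension satisfies $\overline{\dim}_M(Z)<N-\frac{4p}{p-1}$; or (b) $Z$ is a smooth closed (compact, without boundary) embedded $k$-dimensional submanifold of $\mathbb{R}^N$ with $k\le N-\frac{4p}{p-1}$. Here $\overline{\dim}_M(E)=\inf\{\lambda\ge 0 : \limsup_{r\to0^+}\mathcal M^\lambda_r(E)=0\}$, where $\mathcal M^\lambda_r(E)$ is the infimum of $l\,r^\lambda$ over all covers of $E$ by $l$ balls of radius $r$ centred at points of $E$ (for $E=\emptyset$ this infimum, and hence the dimension, is $0$). Let $u\in C^4(\mathbb{R}^N\setminus Z)$ be a positive solution of $\Delta^2u=u^p$ pointwise in $\mathbb{R}^N\setminus Z$. Then for every $x\in\mathbb{R}^N\setminus Z$ the function $y\mapsto u^p(y)\,|x-y|^{4-N}$ is integrable on $\mathbb{R}^N$ and $$u(x)=c_{N,2}\int_{\mathbb{R}^N}\frac{u^p(y)}{|x-y|^{N-4}}\,dy,\qquad c_{N,2}=\frac{\Gamma\left(\frac{N-4}{2}\right)}{2^4\,\pi^{N/2}\,\Gamma(2)}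 .$$ -/

import Mathlib

open Set Filter Topology MeasureTheory
open scoped ENNReal ContDiff

noncomputable section

/-- The `d`-dimensional Minkowski `r`-content of `E`: the infimum of `l * r ^ d` over all covers of
`E` by `l` balls of radius `r` with centres in `E`. It is `⊤` if there is no such finite cover
(which does not happen for compact `E` and `r > 0`). For nonempty `E` a cover necessarily has
`l ≥ 1`; for `E = ∅` the empty cover is admitted, so that the content of `∅` is `0`. -/
def minkowskiContent {N : ℕ} (d r : ℝ) (E : Set (EuclideanSpace ℝ (Fin N))) : ℝ≥0∞ :=
  ⨅ (l : ℕ) (x : Fin l → EuclideanSpace ℝ (Fin N))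
    (_ : (∀ k, x k ∈ E) ∧ E ⊆ ⋃ k, Metric.ball (x k) r),
    (l : ℝ≥0∞) * ENNReal.ofReal (r ^ d)

/-- The upper Minkowski dimension of `E`: the infimum of all `d ≥ 0` such that the limit superior of
the `d`-dimensional Minkowski `r`-contents of `E`, as `r → 0⁺`, vanishes. -/
def upperMinkowskiDim {N : ℕ} (E : Set (EuclideanSpace ℝ (Fin N))) : ℝ≥0∞ :=
  ⨅ (d : ℝ) (_ : 0 ≤ d ∧ limsup (fun r : ℝ => minkowskiContent d r E) (𝓝[>] 0) = 0),
    ENNReal.ofReal d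

/-- `Z ⊆ ℝᴺ` is a smooth `k`-dimensional closed (that is, compact and without boundary) embedded
manifold: it is compact, and near each of its points there is a smooth diffeomorphism `Φ` between
open subsets of `ℝᴺ` that straightens `Z` to the coordinate plane `{y | yᵢ = 0 for i ≥ k}`
(indices starting at `0`). -/
def IsClosedSmoothSubmanifold {N : ℕ} (k : ℕ) (Z : Set (EuclideanSpace ℝ (Fin N))) : Prop :=
  k ≤ N ∧ IsCompact Z ∧
    ∀ z ∈ Z, ∃ Φ : OpenPartialHomeomorph (EuclideanSpace ℝ (Fin N)) (EuclideanSpace ℝ (Fin N)),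
      z ∈ Φ.source ∧ ContDiffOn ℝ ∞ Φ Φ.source ∧ ContDiffOn ℝ ∞ Φ.symm Φ.target ∧
      ∀ x ∈ Φ.source, x ∈ Z ↔ ∀ i : Fin N, k ≤ (i : ℕ) → Φ x i = 0

/-- `u` is a positive punctured solution of `Δ² u = u ^ p` in `ℝᴺ \ Z`: it is of class `C⁴` and
positive there, and satisfies the equation at every point. (The values of `u` on `Z` are
arbitrary.) -/
structure IsPositivePuncturedSolution {N : ℕ} (p : ℝ) (Z : Set (EuclideanSpace ℝ (Fin N)))
    (u : EuclideanSpace ℝ (Fin N) → ℝ) : Prop where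
  contDiffOn : ContDiffOn ℝ 4 u Zᶜ
  pos : ∀ x ∈ Zᶜ, 0 < u x
  eqn : ∀ x ∈ Zᶜ, Laplacian.laplacian (Laplacian.laplacian u) x = u x ^ p

/-- The constant `c_{N,2} = Γ((N-4)/2) / (2⁴ π^{N/2} Γ(2))`. -/
def rieszConst (N : ℕ) : ℝ :=
  Real.Gamma (((N : ℝ) - 4) / 2) / (2 ^ 4 * Real.pi ^ ((N : ℝ) / 2) * Real.Gamma 2)

end

/-! Let q = p/(p-1). Either hypothesis on Z says that its ε-neighbourhood has volume O(ε^(4q))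
(`HasThinNeighborhoods`), and this is all that is used about Z beyond compactness.

Removability. Test the equation with ξ^m, where ξ vanishes near Z and has i-th derivatives of size
ε^(-i). Young's inequality absorbs u^p ξ^m and leaves ∫ |ε^(-4)|^q over the ε-neighbourhood, which
is bounded; hence u^p is locally integrable (`IsNonnegPuncturedSolution.integrableOn_rpow`). By
Hölder, cutting a test function off near Z changes the weak equation by at most ε^(-4) ·
(ε^(4q))^(1/q) · (∫ u^p)^(1/p) over the ε-neighbourhood, up to a constant. The powers of ε cancel
and the last factor tends to 0, so the equation holds in the sense of distributions on the whole
space (`IsNonnegPuncturedSolution.integral_rpow_mul_eq`).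

Growth. The same absorption at scale R gives ∫_{B_R} u^p = O(R^(N-4q)), so the averages of u over
large balls tend to 0 (`IsNonnegPuncturedSolution.tendsto_average`).

Representation. Test with (|y-x|² + δ²)^((4-N)/2) times a cutoff at scale R. The bilaplacian of the
first factor is an explicit approximate identity as δ → 0, and the cutoff costs only an error
O(R^(-N)) on B_{2R}. Letting δ → 0 gives the formula up to a multiple of an average of u; R → ∞
removes it. A Gamma integral identifies the constant. -/

theorem fderiv_comp_smul_sub {E F : Type*} [NormedAddCommGroup E] [NormedSpace ℝ E]
    [NormedAddCommGroup F] [NormedSpace ℝ F] (g : E → F)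
    (c : ℝ) (a : E) :
    fderiv ℝ (fun y => g (c • (y - a))) = fun y => c • fderiv ℝ g (c • (y - a)) := by
  funext y
  rw [fderiv_comp_sub (𝕜 := ℝ) (f := fun y => g (c • y)) (x := y) a, fderiv_comp_smul]

/-! ### The Laplacian as a trace, and integration by parts -/

section Laplacian

set_option maxSynthPendingDepth 3

variable {E : Type*} [NormedAddCommGroup E] [InnerProductSpace ℝ E] [FiniteDimensional ℝ E]

/-- The trace of a continuous bilinear form, as a continuous linear functional. -/
noncomputable def bilinTrace (E : Type*) [NormedAddCommGroup E] [InnerProductSpace ℝ E]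
    [FiniteDimensional ℝ E] : (E →L[ℝ] E →L[ℝ] ℝ) →L[ℝ] ℝ :=
  ∑ i, (ContinuousLinearMap.apply ℝ ℝ (stdOrthonormalBasis ℝ E i)).comp
    (ContinuousLinearMap.apply ℝ (E →L[ℝ] ℝ) (stdOrthonormalBasis ℝ E i))

/-- Factoring through one fixed continuous linear map reduces regularity, scaling and norm bounds
for the Laplacian to facts about `fderiv`. -/
theorem laplacian_eq_trace (f : E → ℝ) :
    Laplacian.laplacian f = fun x => bilinTrace E (fderiv ℝ (fderiv ℝ f) x) := by
  rw [InnerProductSpace.laplacian_eq_iteratedFDeriv_stdOrthonormalBasis]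
  ext x
  simp [bilinTrace, iteratedFDeriv_two_apply]

theorem laplacian_eq_sum_fderiv {f : E → ℝ} {x : E} (hf : ContDiffAt ℝ 2 f x) :
    Laplacian.laplacian f x = ∑ i, fderiv ℝ (fun y => fderiv ℝ f y (stdOrthonormalBasis ℝ E i)) x
      (stdOrthonormalBasis ℝ E i) := by
  have h : DifferentiableAt ℝ (fderiv ℝ f) x :=
    (hf.fderiv_right (m := 1) (by norm_num)).differentiableAt (by norm_num)
  simp [laplacian_eq_trace, bilinTrace, fderiv_clm_apply h (differentiableAt_const _)]

theorem ContDiffAt.laplacian {f : E → ℝ} {x : E} {n m : WithTop ℕ∞} (hf : ContDiffAt ℝ n f x)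
    (h : m + 2 ≤ n) : ContDiffAt ℝ m (Laplacian.laplacian f) x := by
  rw [laplacian_eq_trace]
  refine (bilinTrace E).contDiff.contDiffAt.comp x ?_
  refine ContDiffAt.fderiv_right (n := m + 1) (hf.fderiv_right ?_) le_rfl
  rwa [add_assoc, one_add_one_eq_two]

/-- A constant bounding the bilaplacian in terms of the norm of the fourth derivative. -/
noncomputable def bilaplacianBound (E : Type*) [NormedAddCommGroup E] [InnerProductSpace ℝ E]
    [FiniteDimensional ℝ E] : ℝ := ‖bilinTrace E‖ ^ 2

theorem bilaplacianBound_nonneg : 0 ≤ bilaplacianBound E := sq_nonneg ‖bilinTrace E‖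

theorem abs_bilaplacian_le {f : E → ℝ} {x : E} (hf : ContDiffAt ℝ 4 f x) :
    |Laplacian.laplacian (Laplacian.laplacian f) x| ≤
      bilaplacianBound E * ‖iteratedFDeriv ℝ 4 f x‖ := by
  have h2 (g : E → ℝ) : ‖fderiv ℝ (fderiv ℝ g) x‖ = ‖iteratedFDeriv ℝ 2 g x‖ := by
    rw [← norm_iteratedFDeriv_fderiv, ← norm_iteratedFDeriv_fderiv, norm_iteratedFDeriv_zero]
  have h1 : |Laplacian.laplacian (Laplacian.laplacian f) x| ≤
      ‖bilinTrace E‖ * ‖iteratedFDeriv ℝ 2 (Laplacian.laplacian f) x‖ := by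
    rw [← h2, laplacian_eq_trace (Laplacian.laplacian f), ← Real.norm_eq_abs]
    exact (bilinTrace E).le_opNorm _
  have h3 : ‖iteratedFDeriv ℝ 2 (Laplacian.laplacian f) x‖ ≤
      ‖bilinTrace E‖ * ‖iteratedFDeriv ℝ 4 f x‖ := by
    have h4 : ‖iteratedFDeriv ℝ 4 f x‖ = ‖iteratedFDeriv ℝ 2 (fderiv ℝ (fderiv ℝ f)) x‖ := by
      rw [norm_iteratedFDeriv_fderiv, norm_iteratedFDeriv_fderiv]
    have : ContDiffAt ℝ 2 (fderiv ℝ (fderiv ℝ f)) x :=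
      ContDiffAt.fderiv_right (n := 3) (hf.fderiv_right (by norm_num)) (by norm_num)
    rw [laplacian_eq_trace, h4]
    exact ContinuousLinearMap.norm_iteratedFDeriv_comp_left (bilinTrace E) this le_rfl
  calc _ ≤ _ := h1
    _ ≤ ‖bilinTrace E‖ * (‖bilinTrace E‖ * ‖iteratedFDeriv ℝ 4 f x‖) := by gcongr
    _ = _ := by rw [bilaplacianBound]; ring

theorem bilaplacian_congr {f g : E → ℝ} {x : E} (h : f =ᶠ[𝓝 x] g) :
    Laplacian.laplacian (Laplacian.laplacian f) x =
      Laplacian.laplacian (Laplacian.laplacian g) x :=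
  (InnerProductSpace.laplacian_congr_nhds
    (InnerProductSpace.laplacian_congr_nhds h)).self_of_nhds

theorem laplacian_comp_smul_sub (f : E → ℝ) (c : ℝ) (a : E) :
    Laplacian.laplacian (fun y => f (c • (y - a))) =
      fun y => c ^ 2 * Laplacian.laplacian f (c • (y - a)) := by
  rw [laplacian_eq_trace, laplacian_eq_trace, fderiv_comp_smul_sub]
  ext y
  have h3 : (fun y => c • fderiv ℝ f (c • (y - a))) = c • fun y => fderiv ℝ f (c • (y - a)) := rfl
  rw [h3, fderiv_const_smul_field, Pi.smul_apply, fderiv_comp_smul_sub]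
  simp [smul_smul, sq]

theorem laplacian_const_mul {f : E → ℝ} {x : E} (c : ℝ) (hf : ContDiffAt ℝ 2 f x) :
    Laplacian.laplacian (fun y => c * f y) x = c * Laplacian.laplacian f x :=
  InnerProductSpace.laplacian_smul c hf

theorem tsupport_laplacian_subset (f : E → ℝ) :
    tsupport (Laplacian.laplacian f) ⊆ tsupport f := by
  refine closure_minimal (fun x hx => ?_) (isClosed_tsupport f)
  by_contra h
  apply hx
  have := (InnerProductSpace.laplacian_congr_nhds (notMem_tsupport_iff_eventuallyEq.1 h)).self_of_nhds
  rw [this]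
  exact congrFun (InnerProductSpace.laplacian_const (c := (0 : ℝ))) x

theorem tsupport_bilaplacian_subset (f : E → ℝ) :
    tsupport (Laplacian.laplacian (Laplacian.laplacian f)) ⊆ tsupport f :=
  (tsupport_laplacian_subset _).trans (tsupport_laplacian_subset _)

variable [MeasurableSpace E] [BorelSpace E]

theorem integrable_mul_of_tsupport_subset {f g : E → ℝ} {U : Set E} (hf : ContinuousOn f U)
    (hg : Continuous g) (hgc : HasCompactSupport g) (hgU : tsupport g ⊆ U) :
    Integrable (fun x => f x * g x) := by
  have h : IntegrableOn (fun x => f x * g x) (tsupport g) :=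
    ((hf.mono hgU).mul hg.continuousOn).integrableOn_compact hgc
  rwa [integrableOn_iff_integrable_of_support_subset] at h
  exact fun x hx => subset_tsupport g (fun h0 => hx (by simp [h0]))

/-- Integration by parts twice in each coordinate direction. Nothing is known about f off U, but
every integrand carries g or a derivative of it, whose support is a compact subset of U. -/
theorem integral_laplacian_mul {f g : E → ℝ} {U : Set E} (hU : IsOpen U) (hf : ContDiffOn ℝ 2 f U)
    (hg : ContDiff ℝ 2 g) (hgc : HasCompactSupport g) (hgU : tsupport g ⊆ U) :
    ∫ x, Laplacian.laplacian f x * g x = ∫ x, f x * Laplacian.laplacian g x := by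
  set b := stdOrthonormalBasis ℝ E
  have hfx {x} (hx : x ∈ U) : ContDiffAt ℝ 2 f x := hf.contDiffAt (hU.mem_nhds hx)
  have hdf {x} (hx : x ∈ U) (v : E) : ContDiffAt ℝ 1 (fun y => fderiv ℝ f y v) x :=
    ((hfx hx).fderiv_right (m := 1) (by norm_num)).clm_apply contDiffAt_const
  have hdg (v : E) : ContDiff ℝ 1 (fun y => fderiv ℝ g y v) :=
    (hg.fderiv_right (m := 1) (by norm_num)).clm_apply contDiff_const
  have hddf (v : E) : ContinuousOn (fun x => fderiv ℝ (fun y => fderiv ℝ f y v) x v) U := fun x hx =>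
    (((hdf hx v).fderiv_right (m := 0) (by norm_num)).clm_apply
      contDiffAt_const).continuousAt.continuousWithinAt
  have hddg (v : E) : Continuous (fun x => fderiv ℝ (fun y => fderiv ℝ g y v) x v) :=
    (((hdg v).fderiv_right (m := 0) (by norm_num)).clm_apply contDiff_const).continuous
  have hsg (v : E) : tsupport (fun y => fderiv ℝ g y v) ⊆ tsupport g :=
    closure_minimal (fun x (hx : fderiv ℝ g x v ≠ 0) => support_fderiv_subset ℝ (f := g)
      (fun h : fderiv ℝ g x = 0 => hx (by simp [h]))) (isClosed_tsupport g)
  have hcg (v : E) : HasCompactSupport (fun y => fderiv ℝ g y v) :=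
    hgc.of_isClosed_subset (isClosed_tsupport _) (hsg v)
  have hsg2 (v : E) : tsupport (fun x => fderiv ℝ (fun y => fderiv ℝ g y v) x v) ⊆ tsupport g :=
    (closure_minimal (fun x (hx : fderiv ℝ (fun y => fderiv ℝ g y v) x v ≠ 0) =>
      support_fderiv_subset ℝ (f := fun y => fderiv ℝ g y v)
      (fun h : fderiv ℝ (fun y => fderiv ℝ g y v) x = 0 => hx (by simp [h]))) (isClosed_tsupport _)).trans (hsg v)
  have hcg2 (v : E) : HasCompactSupport (fun x => fderiv ℝ (fun y => fderiv ℝ g y v) x v) :=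
    hgc.of_isClosed_subset (isClosed_tsupport _) (hsg2 v)
  have i1 (v : E) : Integrable (fun x => fderiv ℝ (fun y => fderiv ℝ f y v) x v * g x) :=
    integrable_mul_of_tsupport_subset (hddf v) hg.continuous hgc hgU
  have i2 (v : E) : Integrable (fun x => f x * fderiv ℝ (fun y => fderiv ℝ g y v) x v) :=
    integrable_mul_of_tsupport_subset hf.continuousOn (hddg v) (hcg2 v) ((hsg2 v).trans hgU)
  have i3 (v : E) : Integrable (fun x => fderiv ℝ f x v * fderiv ℝ g x v) :=
    integrable_mul_of_tsupport_subset (U := U)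
      (fun x hx => (hdf hx v).continuousAt.continuousWithinAt)
      (hdg v).continuous (hcg v) ((hsg v).trans hgU)
  have key (v : E) : ∫ x, fderiv ℝ (fun y => fderiv ℝ f y v) x v * g x =
      ∫ x, f x * fderiv ℝ (fun y => fderiv ℝ g y v) x v := by
    have e1 := integral_mul_fderiv_eq_neg_fderiv_mul_of_integrable (μ := volume)
      (f := fun y => fderiv ℝ f y v) (g := g) (v := v) (i1 v) (i3 v)
      (integrable_mul_of_tsupport_subset (U := U)
        (fun x hx => (hdf hx v).continuousAt.continuousWithinAt) hg.continuous hgc hgU)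
      (fun x hx => (hdf (hgU hx) v).differentiableAt (by norm_num))
      (fun x _ => hg.differentiable (by norm_num) x)
    have e2 := integral_mul_fderiv_eq_neg_fderiv_mul_of_integrable (μ := volume)
      (f := f) (g := fun y => fderiv ℝ g y v) (v := v) (i3 v) (i2 v)
      (integrable_mul_of_tsupport_subset hf.continuousOn (hdg v).continuous (hcg v)
        ((hsg v).trans hgU))
      (fun x hx => (hfx (hgU (hsg v hx))).differentiableAt (by norm_num))
      (fun x _ => (hdg v).differentiable (by norm_num) x)
    linarith
  have e1 : (fun x => Laplacian.laplacian f x * g x) =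
      fun x => ∑ i, fderiv ℝ (fun y => fderiv ℝ f y (b i)) x (b i) * g x := by
    ext x
    by_cases hx : x ∈ tsupport g
    · rw [laplacian_eq_sum_fderiv (hfx (hgU hx)), Finset.sum_mul]
    · simp [image_eq_zero_of_notMem_tsupport hx]
  have e2 : (fun x => f x * Laplacian.laplacian g x) =
      fun x => ∑ i, f x * fderiv ℝ (fun y => fderiv ℝ g y (b i)) x (b i) := by
    ext x
    rw [laplacian_eq_sum_fderiv hg.contDiffAt, Finset.mul_sum]
  rw [e1, e2, integral_finsetSum _ (fun i _ => i1 _), integral_finsetSum _ (fun i _ => i2 _)]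
  exact Finset.sum_congr rfl fun i _ => key _

theorem integral_bilaplacian_mul {f g : E → ℝ} {U : Set E} (hU : IsOpen U)
    (hf : ContDiffOn ℝ 4 f U) (hg : ContDiff ℝ 4 g) (hgc : HasCompactSupport g)
    (hgU : tsupport g ⊆ U) :
    ∫ x, Laplacian.laplacian (Laplacian.laplacian f) x * g x =
      ∫ x, f x * Laplacian.laplacian (Laplacian.laplacian g) x := by
  have hlf : ContDiffOn ℝ 2 (Laplacian.laplacian f) U := fun x hx =>
    ((hf.contDiffAt (hU.mem_nhds hx)).laplacian (by norm_num)).contDiffWithinAt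
  have hlg : ContDiff ℝ 2 (Laplacian.laplacian g) :=
    contDiff_iff_contDiffAt.2 fun x => hg.contDiffAt.laplacian (by norm_num)
  rw [integral_laplacian_mul hU hlf (hg.of_le (by norm_num)) hgc hgU,
    integral_laplacian_mul hU (hf.of_le (by norm_num)) hlg
      (hgc.of_isClosed_subset (isClosed_tsupport _) (tsupport_laplacian_subset g))
      ((tsupport_laplacian_subset g).trans hgU)]

end Laplacian

/-! ### Smooth cutoffs near an arbitrary set -/

section Cutoff

open scoped Convolution

/-- Chain rule bound with outer function t ↦ t^m, and 24 = 4!. At most four powers of f are lost;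
the surviving f^(m-4) is what lets Young's inequality close later. -/
theorem norm_iteratedFDeriv_pow_le {E : Type*} [NormedAddCommGroup E] [NormedSpace ℝ E]
    {f : E → ℝ} (hf : ContDiff ℝ 4 f) {x : E} (h0 : 0 ≤ f x) (h1 : f x ≤ 1) {m : ℕ} (hm : 4 ≤ m)
    {D : ℝ} (hD : ∀ i, 1 ≤ i → i ≤ 4 → ‖iteratedFDeriv ℝ i f x‖ ≤ D ^ i) :
    ‖iteratedFDeriv ℝ 4 (fun y => f y ^ m) x‖ ≤ 24 * ((m : ℝ) ^ 4 * f x ^ (m - 4)) * D ^ 4 := by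
  have h := norm_iteratedFDeriv_comp_le (𝕜 := ℝ) (g := fun t : ℝ => t ^ m) (f := f) (n := 4) (N := 4)
    (contDiff_id.pow m) hf le_rfl x (C := (m : ℝ) ^ 4 * f x ^ (m - 4)) (D := D) ?_ hD
  · simpa [Nat.factorial, Function.comp_def] using h
  intro i hi
  rw [norm_iteratedFDeriv_eq_norm_iteratedDeriv, iteratedDeriv_eq_iterate, iter_deriv_pow,
    norm_mul, norm_pow, Real.norm_of_nonneg h0, norm_prod]
  have hm1 : (1 : ℝ) ≤ m := by exact_mod_cast (by omega : 1 ≤ m)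
  refine mul_le_mul ?_ (pow_le_pow_of_le_one h0 h1 (by omega)) (by positivity) (by positivity)
  calc ∏ j ∈ Finset.range i, ‖(m : ℝ) - j‖ ≤ ∏ j ∈ Finset.range i, (m : ℝ) := by
        refine Finset.prod_le_prod (fun _ _ => norm_nonneg _) fun j hj => ?_
        have : (j : ℝ) ≤ m := by
          have := Finset.mem_range.1 hj
          exact_mod_cast (by omega : j ≤ m)
        rw [Real.norm_of_nonneg (by linarith)]
        linarith [(Nat.cast_nonneg j : (0 : ℝ) ≤ j)]
    _ = (m : ℝ) ^ i := by simp
    _ ≤ (m : ℝ) ^ 4 := pow_le_pow_right₀ hm1 hi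

theorem norm_iteratedFDeriv_comp_smul_sub_le {E F : Type*} [NormedAddCommGroup E]
    [NormedSpace ℝ E] [NormedAddCommGroup F] [NormedSpace ℝ F] {f : E → F} {n : ℕ}
    (hf : ContDiff ℝ n f) (c : ℝ) (a y : E) :
    ‖iteratedFDeriv ℝ n (fun y => f (c • (y - a))) y‖ ≤
      |c| ^ n * ‖iteratedFDeriv ℝ n f (c • (y - a))‖ := by
  have h1 := iteratedFDeriv_comp_sub (𝕜 := ℝ) (f := fun y => f (c • y)) n a y
  rw [h1]
  have h2 := (c • ContinuousLinearMap.id ℝ E).iteratedFDeriv_comp_right hf (y - a)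
    (i := n) le_rfl
  have h3 : f ∘ (c • ContinuousLinearMap.id ℝ E) = fun y => f (c • y) := by
    ext; simp
  rw [h3] at h2
  rw [h2]
  refine (ContinuousMultilinearMap.norm_compContinuousLinearMap_le _ _).trans ?_
  rw [mul_comm]
  simp only [Finset.prod_const, Finset.card_univ, Fintype.card_fin, FunLike.coe_smul,
    ContinuousLinearMap.coe_id', Pi.smul_apply, id_eq]
  gcongr
  rw [norm_smul, Real.norm_eq_abs]
  exact mul_le_of_le_one_right (abs_nonneg c) ContinuousLinearMap.norm_id_le

variable {E : Type} [NormedAddCommGroup E] [InnerProductSpace ℝ E] [FiniteDimensional ℝ E]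
  [MeasurableSpace E] [BorelSpace E]

/-- All derivatives fall on φ, and |f| ≤ 1. The induction runs over all codomains `F`, since
differentiating φ changes its codomain. -/
theorem norm_iteratedFDeriv_convolution_le {f : E → ℝ} (hf : Measurable f)
    (hf1 : ∀ x, ‖f x‖ ≤ 1) (n : ℕ) {F : Type} [NormedAddCommGroup F] [NormedSpace ℝ F]
    [CompleteSpace F] {φ : E → F} (hφ : ContDiff ℝ ∞ φ) (hφc : HasCompactSupport φ) (y : E) :
    ‖iteratedFDeriv ℝ n (f ⋆[ContinuousLinearMap.lsmul ℝ ℝ, volume] φ) y‖ ≤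
      ∫ w, ‖iteratedFDeriv ℝ n φ w‖ := by
  have hfl : LocallyIntegrable f volume :=
    (locallyIntegrable_const (1 : ℝ)).mono hf.aestronglyMeasurable
      (Eventually.of_forall fun x => by simpa using hf1 x)
  induction n generalizing F with
  | zero =>
    simp only [norm_iteratedFDeriv_zero]
    rw [convolution_def]
    calc ‖∫ t, ContinuousLinearMap.lsmul ℝ ℝ (f t) (φ (y - t))‖ ≤ ∫ t, ‖φ (y - t)‖ := by
          refine norm_integral_le_of_norm_le ?_ (Eventually.of_forall fun t => ?_)
          · exact ((hφ.continuous.integrable_of_hasCompactSupport hφc).norm).comp_sub_left y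
          · simp only [ContinuousLinearMap.lsmul_apply, norm_smul]
            exact mul_le_of_le_one_left (norm_nonneg _) (hf1 t)
      _ = ∫ w, ‖φ w‖ := integral_sub_left_eq_self (fun w => ‖φ w‖) volume y
  | succ n ih =>
    have h1 : fderiv ℝ (f ⋆[ContinuousLinearMap.lsmul ℝ ℝ, volume] φ) =
        f ⋆[ContinuousLinearMap.lsmul ℝ ℝ, volume] (fderiv ℝ φ) := by
      ext1 x
      rw [(hφc.hasFDerivAt_convolution_right (ContinuousLinearMap.lsmul ℝ ℝ) hfl
        (hφ.of_le (by simp)) x).fderiv, convolution_def, convolution_def]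
      rfl
    simp only [← norm_iteratedFDeriv_fderiv]
    rw [h1]
    exact ih (hφ.fderiv_right (m := ∞) (by simp)) (hφc.fderiv ℝ)

/-- Smooth functions vanishing near `K` and equal to `1` away from `K`, with derivatives controlled
by powers of the inverse distance, uniformly in `K`. -/
theorem exists_cutoff : ∃ A : ℝ, 1 ≤ A ∧ ∀ (K : Set E) (ε : ℝ), 0 < ε → ∃ η : E → ℝ,
    ContDiff ℝ ∞ η ∧ (∀ y, 0 ≤ η y) ∧ (∀ y, η y ≤ 1) ∧
    (∀ y ∈ Metric.thickening (ε / 4) K, η y = 0) ∧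
    (∀ y ∉ Metric.thickening ε K, η =ᶠ[𝓝 y] fun _ => 1) ∧
    ∀ i, 1 ≤ i → i ≤ 4 → ∀ y, ‖iteratedFDeriv ℝ i η y‖ ≤ (A / ε) ^ i := by
  let b : ContDiffBump (0 : E) := ⟨1 / 2, 1, by norm_num, by norm_num⟩
  set φ : E → ℝ := b.normed volume
  have hφ : ContDiff ℝ ∞ φ := b.contDiff_normed
  have hφc : HasCompactSupport φ := b.hasCompactSupport_normed
  have hφ0 (w : E) (hw : 1 ≤ ‖w‖) : φ w = 0 := by
    have : w ∉ Function.support φ := by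
      rw [b.support_normed_eq]; simpa [b] using hw
    simpa using this
  set M : ℝ := 1 + ∑ i ∈ Finset.range 5, ∫ w, ‖iteratedFDeriv ℝ i φ w‖
  have hM0 (i : ℕ) : 0 ≤ ∫ w, ‖iteratedFDeriv ℝ i φ w‖ := integral_nonneg fun _ => norm_nonneg _
  have hM1 : 1 ≤ M := le_add_of_nonneg_right (Finset.sum_nonneg fun i _ => hM0 i)
  have hMi (i : ℕ) (hi : i ≤ 4) : ∫ w, ‖iteratedFDeriv ℝ i φ w‖ ≤ M :=
    (Finset.single_le_sum (f := fun i => ∫ w, ‖iteratedFDeriv ℝ i φ w‖) (fun i _ => hM0 i)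
      (Finset.mem_range.2 (by omega : i < 5))).trans (by simp [M])
  refine ⟨4 * M, by linarith, fun K ε hε => ?_⟩
  -- In units of ε/4: mollify the indicator of the 2-neighbourhood with a kernel of radius 1. The
  -- result H is 1 on the 1-neighbourhood and 0 off the 3-neighbourhood, and the cutoff is 1 - H.
  -- The gap between 3 and 4 makes the cutoff constant near every point off the ε-neighbourhood.
  set S : Set E := {w | (ε / 4) • w ∈ Metric.thickening (2 * (ε / 4)) K} with hS
  have hSo : IsOpen S := Metric.isOpen_thickening.preimage (continuous_const_smul (ε / 4))
  set f : E → ℝ := S.indicator 1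
  have hf : Measurable f := measurable_one.indicator hSo.measurableSet
  have hf1 (x : E) : ‖f x‖ ≤ 1 := by
    by_cases hx : x ∈ S <;> simp [f, hx]
  have hfl : LocallyIntegrable f volume :=
    (locallyIntegrable_const (1 : ℝ)).mono hf.aestronglyMeasurable
      (Eventually.of_forall fun x => by simpa using hf1 x)
  set H : E → ℝ := f ⋆[ContinuousLinearMap.lsmul ℝ ℝ, volume] φ
  have hH : ContDiff ℝ ∞ H := hφc.contDiff_convolution_right _ hfl hφ
  have hHx (x : E) : H x = ∫ t, f t * φ (x - t) := rfl
  have hφi (x : E) : Integrable (fun t => φ (x - t)) :=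
    (hφ.continuous.integrable_of_hasCompactSupport hφc).comp_sub_left x
  have hφ1 (x : E) : ∫ t, φ (x - t) = 1 := by
    rw [integral_sub_left_eq_self φ volume x]; exact b.integral_normed
  have hf0 (t : E) : 0 ≤ f t := indicator_nonneg (fun _ _ => zero_le_one) t
  have hf1' (t : E) : f t ≤ 1 := (le_abs_self _).trans (hf1 t)
  have hφp (w : E) : 0 ≤ φ w := b.nonneg_normed w
  have hfi (x : E) : Integrable (fun t => f t * φ (x - t)) :=
    (hφi x).bdd_mul hf.aestronglyMeasurable (Eventually.of_forall hf1)
  have hH0 (x : E) : 0 ≤ H x := integral_nonneg fun t => mul_nonneg (hf0 t) (hφp _)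
  have hH1 (x : E) : H x ≤ 1 := by
    rw [hHx, ← hφ1 x]
    exact integral_mono (hfi x) (hφi x) fun t => mul_le_of_le_one_left (hφp _) (hf1' t)
  have h4 : (4 / ε) * (ε / 4) = 1 := by field_simp
  have h4' (y t : E) : dist y ((ε / 4) • t) = ε / 4 * ‖(4 / ε) • y - t‖ := by
    have : y - (ε / 4) • t = (ε / 4) • ((4 / ε) • y - t) := by
      rw [smul_sub, smul_smul, mul_comm, h4, one_smul]
    rw [dist_eq_norm, this, norm_smul, Real.norm_of_nonneg (by positivity)]
  have hin (y : E) (hy : y ∈ Metric.thickening (ε / 4) K) : H ((4 / ε) • y) = 1 := by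
    rw [hHx, ← hφ1 ((4 / ε) • y)]
    refine integral_congr_ae (Eventually.of_forall fun t => ?_)
    rcases le_or_gt 1 ‖(4 / ε) • y - t‖ with h | h
    · simp [hφ0 _ h]
    · have : t ∈ S := by
        obtain ⟨z, hz, hyz⟩ := Metric.mem_thickening_iff.1 hy
        refine Metric.mem_thickening_iff.2 ⟨z, hz, ?_⟩
        have := dist_triangle_left ((ε / 4) • t) z y
        rw [h4'] at this
        nlinarith
      simp [f, this]
  have hout (y : E) (hy : y ∉ Metric.thickening (3 * (ε / 4)) K) : H ((4 / ε) • y) = 0 := by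
    rw [hHx]
    refine integral_eq_zero_of_ae (Eventually.of_forall fun t => ?_)
    rcases le_or_gt 1 ‖(4 / ε) • y - t‖ with h | h
    · simp [hφ0 _ h]
    · have : t ∉ S := by
        intro ht
        obtain ⟨z, hz, hyz⟩ := Metric.mem_thickening_iff.1 ht
        refine hy (Metric.mem_thickening_iff.2 ⟨z, hz, ?_⟩)
        have := dist_triangle y ((ε / 4) • t) z
        rw [h4'] at this
        nlinarith
      simp [f, this]
  have hHs : ContDiff ℝ ∞ (fun y => H ((4 / ε) • y)) := hH.comp (contDiff_id.const_smul _)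
  refine ⟨fun y => 1 - H ((4 / ε) • y), contDiff_const.sub hHs, fun y => by linarith [hH1 ((4 / ε) • y)],
    fun y => by linarith [hH0 ((4 / ε) • y)], fun y hy => by simp [hin y hy], fun y hy => ?_,
    fun i hi1 hi4 y => ?_⟩
  · have : (Metric.cthickening (3 * (ε / 4)) K)ᶜ ∈ 𝓝 y :=
      Metric.isClosed_cthickening.isOpen_compl.mem_nhds fun h =>
        hy (Metric.cthickening_subset_thickening' hε (by linarith) K h)
    filter_upwards [this] with w hw
    rw [hout w fun h => hw (Metric.thickening_subset_cthickening _ _ h), sub_zero]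
  · have e1 : iteratedFDeriv ℝ i (fun y => 1 - H ((4 / ε) • y)) y =
        - iteratedFDeriv ℝ i (fun y => H ((4 / ε) • y)) y := by
      have : (fun y => 1 - H ((4 / ε) • y)) = (fun _ => (1 : ℝ)) - fun y => H ((4 / ε) • y) := rfl
      rw [this, iteratedFDeriv_sub_apply contDiff_const.contDiffAt
        (hHs.of_le (by exact_mod_cast le_top)).contDiffAt,
        iteratedFDeriv_const_of_ne (by omega), Pi.zero_apply, zero_sub]
    rw [e1, norm_neg]
    have e2 := norm_iteratedFDeriv_comp_smul_sub_le (n := i) (f := H)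
      (hH.of_le (by exact_mod_cast le_top)) (4 / ε) 0 y
    simp only [sub_zero] at e2
    refine e2.trans ?_
    have e3 := (norm_iteratedFDeriv_convolution_le hf hf1 i hφ hφc ((4 / ε) • y)).trans (hMi i hi4)
    rw [abs_of_pos (by positivity)]
    calc (4 / ε) ^ i * ‖iteratedFDeriv ℝ i H ((4 / ε) • y)‖ ≤ (4 / ε) ^ i * M ^ i := by
          gcongr
          exact e3.trans (le_self_pow₀ hM1 (by omega))
      _ = (4 * M / ε) ^ i := by rw [← mul_pow]; congr 1; ring

end Cutoff

/-! ### Limit and integral inequalities -/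

/-- Fatou makes f integrable, and then f itself dominates the sequence. It serves three limits:
cutoffs shrinking to Z, δ → 0, and R → ∞. -/
theorem integrable_and_tendsto_of_le_of_integral_le {α : Type*} [MeasurableSpace α] {μ : Measure α}
    {F : ℕ → α → ℝ} {f : α → ℝ} (hF : ∀ j, Integrable (F j) μ) (h0 : ∀ j, ∀ᵐ x ∂μ, 0 ≤ F j x)
    (hle : ∀ j, ∀ᵐ x ∂μ, F j x ≤ f x)
    (hlim : ∀ᵐ x ∂μ, Tendsto (fun j => F j x) atTop (𝓝 (f x))) {B : ℝ}
    (hB : ∀ j, ∫ x, F j x ∂μ ≤ B) :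
    Integrable f μ ∧ Tendsto (fun j => ∫ x, F j x ∂μ) atTop (𝓝 (∫ x, f x ∂μ)) := by
  have hm : AEStronglyMeasurable f μ := aestronglyMeasurable_of_tendsto_ae atTop
    (fun j => (hF j).aestronglyMeasurable) hlim
  have hf0 : ∀ᵐ x ∂μ, 0 ≤ f x := by
    filter_upwards [h0 0, hle 0] with x h1 h2 using h1.trans h2
  have hi : Integrable f μ := by
    refine ⟨hm, ?_⟩
    rw [hasFiniteIntegral_iff_ofReal hf0]
    have h1 : ∫⁻ x, ENNReal.ofReal (f x) ∂μ ≤ ENNReal.ofReal B :=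
      calc ∫⁻ x, ENNReal.ofReal (f x) ∂μ
          = ∫⁻ x, liminf (fun j => ENNReal.ofReal (F j x)) atTop ∂μ := by
            refine lintegral_congr_ae ?_
            filter_upwards [hlim] with x hx
            exact ((ENNReal.continuous_ofReal.tendsto _).comp hx).liminf_eq.symm
        _ ≤ liminf (fun j => ∫⁻ x, ENNReal.ofReal (F j x) ∂μ) atTop :=
            lintegral_liminf_le' fun j => (hF j).aestronglyMeasurable.aemeasurable.ennreal_ofReal
        _ ≤ ENNReal.ofReal B := by
            refine liminf_le_of_frequently_le' (Frequently.of_forall fun j => ?_)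
            rw [← ofReal_integral_eq_lintegral_ofReal (hF j) (h0 j)]
            exact ENNReal.ofReal_le_ofReal (hB j)
    exact h1.trans_lt ENNReal.ofReal_lt_top
  refine ⟨hi, tendsto_integral_of_dominated_convergence f (fun j => (hF j).aestronglyMeasurable) hi
    (fun j => ?_) hlim⟩
  filter_upwards [h0 j, hle j] with x h1 h2
  rwa [Real.norm_of_nonneg h1]

theorem setIntegral_le_rpow_mul_measure_rpow {α : Type*} [MeasurableSpace α] {μ : Measure α}
    {p q : ℝ} (hpq : p.HolderConjugate q) {u : α → ℝ} (hu : Measurable u) (hu0 : ∀ x, 0 ≤ u x)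
    {S : Set α} (hS : μ S ≠ ⊤) (hi : IntegrableOn (fun x => u x ^ p) S μ) :
    ∫ x in S, u x ∂μ ≤ (∫ x in S, u x ^ p ∂μ) ^ (1 / p) * (μ.real S) ^ (1 / q) := by
  have : IsFiniteMeasure (μ.restrict S) := ⟨by simpa using hS.lt_top⟩
  have h := integral_mul_le_Lp_mul_Lq_of_nonneg (μ := μ.restrict S) hpq (f := u) (g := fun _ => 1)
    (Eventually.of_forall hu0) (Eventually.of_forall fun _ => zero_le_one) ?_ (memLp_const _)
  · simpa [Measure.real] using h
  · rw [← integrable_norm_rpow_iff hu.aestronglyMeasurable (by simpa using hpq.pos) (by simp),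
      ENNReal.toReal_ofReal hpq.nonneg]
    exact hi.congr (Eventually.of_forall fun x => by simp only [Real.norm_of_nonneg (hu0 x)])

/-- Pointwise u ≤ 1 + u^p. -/
theorem integrableOn_of_rpow {α : Type*} [MeasurableSpace α] {μ : Measure α} {p : ℝ} (hp : 1 ≤ p)
    {u : α → ℝ} (hu : Measurable u) (hu0 : ∀ x, 0 ≤ u x) {S : Set α} (hS : μ S ≠ ⊤)
    (hi : IntegrableOn (fun x => u x ^ p) S μ) : IntegrableOn u S μ := by
  have h1 : IntegrableOn (fun x => 1 + u x ^ p) S μ := (integrableOn_const hS).add hi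
  refine h1.mono' hu.aestronglyMeasurable (Eventually.of_forall fun x => ?_)
  rw [Real.norm_of_nonneg (hu0 x)]
  rcases le_total (u x) 1 with h | h
  · linarith [Real.rpow_nonneg (hu0 x) p]
  · linarith [Real.self_le_rpow_of_one_le h hp]

/-- The absorption argument: Young gives uL ≤ u^p ξ^m / p + G^q / q. The first term is moved to the
left, where 1 - 1/p = 1/q remains, so no constant appears. -/
theorem integral_rpow_mul_pow_le {α : Type*} [MeasurableSpace α] {μ : Measure α} {p q : ℝ}
    (hpq : p.HolderConjugate q) {m : ℕ} (hm4 : 4 < m) (hm : 4 * q ≤ m) {u ξ L G : α → ℝ}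
    (hu0 : ∀ x, 0 ≤ u x) (hξ0 : ∀ x, 0 ≤ ξ x) (hξ1 : ∀ x, ξ x ≤ 1) (hG0 : ∀ x, 0 ≤ G x)
    (hL : ∀ x, L x ≤ ξ x ^ (m - 4) * G x) (hi1 : Integrable (fun x => u x ^ p * ξ x ^ m) μ)
    (hi2 : Integrable (fun x => u x * L x) μ) (hi3 : Integrable (fun x => G x ^ q) μ)
    (h : ∫ x, u x ^ p * ξ x ^ m ∂μ = ∫ x, u x * L x ∂μ) :
    ∫ x, u x ^ p * ξ x ^ m ∂μ ≤ ∫ x, G x ^ q ∂μ := by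
  have hpt (x : α) : u x * L x ≤ (u x ^ p * ξ x ^ m) / p + G x ^ q / q := by
    have hb : 0 ≤ u x * ξ x ^ (m - 4) := mul_nonneg (hu0 x) (pow_nonneg (hξ0 x) _)
    have h1 : u x * L x ≤ (u x * ξ x ^ (m - 4)) * G x := by
      rw [mul_assoc]; exact mul_le_mul_of_nonneg_left (hL x) (hu0 x)
    have h2 := Real.young_inequality_of_nonneg hb (hG0 x) hpq
    have h3 : (u x * ξ x ^ (m - 4)) ^ p ≤ u x ^ p * ξ x ^ m := by
      rw [Real.mul_rpow (hu0 x) (pow_nonneg (hξ0 x) _)]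
      refine mul_le_mul_of_nonneg_left ?_ (Real.rpow_nonneg (hu0 x) p)
      rcases (hξ0 x).eq_or_lt with h0 | h0
      · rw [← h0, zero_pow (by omega), Real.zero_rpow hpq.ne_zero, zero_pow (by omega)]
      · rw [← Real.rpow_natCast, ← Real.rpow_mul (hξ0 x), ← Real.rpow_natCast (ξ x) m]
        refine Real.rpow_le_rpow_of_exponent_ge h0 (hξ1 x) ?_
        rw [Nat.cast_sub hm4.le]
        push_cast
        -- The exponent condition (m - 4)p ≥ m is equivalent to m ≥ 4q.
        nlinarith [hpq.sub_one_mul_conj, hpq.sub_one_pos]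
    have h4 : (u x * ξ x ^ (m - 4)) ^ p / p ≤ (u x ^ p * ξ x ^ m) / p :=
      div_le_div_of_nonneg_right h3 hpq.nonneg
    linarith
  have h1 := integral_mono hi2 ((hi1.div_const p).add (hi3.div_const q)) hpt
  rw [Pi.add_def, integral_add (hi1.div_const p) (hi3.div_const q), integral_div, integral_div, ← h] at h1
  set X := ∫ x, u x ^ p * ξ x ^ m ∂μ
  set Y := ∫ x, G x ^ q ∂μ
  have h2 : X * q⁻¹ ≤ Y * q⁻¹ := by
    rw [← hpq.one_sub_inv] at *
    rw [div_eq_mul_inv, div_eq_mul_inv, ← hpq.one_sub_inv] at h1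
    linarith
  exact le_of_mul_le_mul_right h2 hpq.symm.inv_pos

/-! ### Cutoffs on balls at scale R -/

section BallCutoff

variable {E : Type} [NormedAddCommGroup E] [InnerProductSpace ℝ E]

/-- A fixed smooth function which is `1` on the unit ball and `0` outside the ball of radius `2`. -/
noncomputable def unitCutoff (E : Type) [NormedAddCommGroup E] [InnerProductSpace ℝ E] :
    ContDiffBump (0 : E) := ⟨1, 2, one_pos, one_lt_two⟩

/-- The rescaling of `unitCutoff` to the ball of radius `R` around `x`. -/
noncomputable def ballCutoff (R : ℝ) (x y : E) : ℝ := unitCutoff E (R⁻¹ • (y - x))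

theorem norm_inv_smul_sub {R : ℝ} (hR : 0 < R) (x y : E) : ‖R⁻¹ • (y - x)‖ = dist y x / R := by
  rw [norm_smul, norm_inv, Real.norm_of_nonneg hR.le, dist_eq_norm]; ring

theorem ballCutoff_nonneg (R : ℝ) (x y : E) : 0 ≤ ballCutoff R x y := (unitCutoff E).nonneg

theorem ballCutoff_le_one (R : ℝ) (x y : E) : ballCutoff R x y ≤ 1 := (unitCutoff E).le_one

theorem ballCutoff_eq_one {R : ℝ} (hR : 0 < R) {x y : E} (h : dist y x ≤ R) :
    ballCutoff R x y = 1 := by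
  refine (unitCutoff E).one_of_mem_closedBall ?_
  rw [mem_closedBall_zero_iff, norm_inv_smul_sub hR]
  exact (div_le_one hR).2 h

theorem ballCutoff_eq_zero {R : ℝ} (hR : 0 < R) {x y : E} (h : 2 * R ≤ dist y x) :
    ballCutoff R x y = 0 := by
  refine (unitCutoff E).zero_of_le_dist ?_
  rw [dist_zero_right, norm_inv_smul_sub hR]
  exact (le_div_iff₀ hR).2 h

theorem tsupport_ballCutoff_subset {R : ℝ} (hR : 0 < R) (x : E) :
    tsupport (ballCutoff R x) ⊆ Metric.closedBall x (2 * R) := by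
  refine closure_minimal (fun y hy => ?_) Metric.isClosed_closedBall
  by_contra h
  exact hy (ballCutoff_eq_zero hR (by rw [Metric.mem_closedBall, not_le] at h; exact h.le))

theorem exists_norm_iteratedFDeriv_le {f : E → ℝ} (hf : ContDiff ℝ ∞ f) (hc : HasCompactSupport f) :
    ∃ B : ℝ, 1 ≤ B ∧ ∀ i ≤ 4, ∀ y, ‖iteratedFDeriv ℝ i f y‖ ≤ B := by
  have h (i : ℕ) : ∃ B : ℝ, ∀ y, ‖iteratedFDeriv ℝ i f y‖ ≤ B :=
    (hc.iteratedFDeriv i).exists_bound_of_continuous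
      (hf.continuous_iteratedFDeriv (by exact_mod_cast le_top))
  choose B hB using h
  refine ⟨1 + ∑ i ∈ Finset.range 5, |B i|, le_add_of_nonneg_right
    (Finset.sum_nonneg fun i _ => abs_nonneg _), fun i hi y => ?_⟩
  have := Finset.single_le_sum (f := fun i => |B i|) (fun i _ => abs_nonneg _)
    (Finset.mem_range.2 (by omega : i < 5))
  have h2 := (hB i y).trans (le_abs_self _)
  beta_reduce at this
  linarith

variable [FiniteDimensional ℝ E]

theorem contDiff_ballCutoff (R : ℝ) (x : E) : ContDiff ℝ ∞ (ballCutoff R x) :=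
  (unitCutoff E).contDiff.comp ((contDiff_id.sub contDiff_const).const_smul _)

theorem hasCompactSupport_ballCutoff {R : ℝ} (hR : 0 < R) (x : E) :
    HasCompactSupport (ballCutoff R x) :=
  (isCompact_closedBall x (2 * R)).of_isClosed_subset (isClosed_tsupport _)
    (tsupport_ballCutoff_subset hR x)

theorem exists_norm_iteratedFDeriv_ballCutoff_le : ∃ B : ℝ, 1 ≤ B ∧ ∀ (R : ℝ) (x : E), 0 < R →
    ∀ i, 1 ≤ i → i ≤ 4 → ∀ y, ‖iteratedFDeriv ℝ i (ballCutoff R x) y‖ ≤ (B / R) ^ i := by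
  obtain ⟨B, hB1, hB⟩ := exists_norm_iteratedFDeriv_le (unitCutoff E).contDiff
    (unitCutoff E).hasCompactSupport
  refine ⟨B, hB1, fun R x hR i hi1 hi4 y => ?_⟩
  have h1 := norm_iteratedFDeriv_comp_smul_sub_le (n := i) (f := unitCutoff E)
    (unitCutoff E).contDiff R⁻¹ x y
  refine h1.trans ?_
  rw [abs_of_pos (inv_pos.2 hR), div_eq_inv_mul, mul_pow]
  gcongr
  exact (hB i hi4 _).trans (le_self_pow₀ hB1 (by omega))

end BallCutoff

/-! ### Local integrability of u^p across Z -/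

section Removability

variable {E : Type} [NormedAddCommGroup E] [InnerProductSpace ℝ E] [FiniteDimensional ℝ E]

theorem abs_bilaplacian_pow_le {ξ : E → ℝ} (hξ : ContDiff ℝ 4 ξ) {x : E} (h0 : 0 ≤ ξ x)
    (h1 : ξ x ≤ 1) {m : ℕ} (hm : 4 ≤ m) {D : ℝ}
    (hD : ∀ i, 1 ≤ i → i ≤ 4 → ‖iteratedFDeriv ℝ i ξ x‖ ≤ D ^ i) :
    |Laplacian.laplacian (Laplacian.laplacian fun y => ξ y ^ m) x| ≤
      ξ x ^ (m - 4) * (bilaplacianBound E * 24 * (m : ℝ) ^ 4 * D ^ 4) := by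
  refine (abs_bilaplacian_le (hξ.pow m).contDiffAt).trans ?_
  have := mul_le_mul_of_nonneg_left (norm_iteratedFDeriv_pow_le hξ h0 h1 hm hD)
    (bilaplacianBound_nonneg (E := E))
  linarith

variable [MeasurableSpace E] [BorelSpace E]

/-- A measurable, everywhere nonnegative solution of `Δ² u = u ^ p` off `Z`. -/
structure IsNonnegPuncturedSolution (p : ℝ) (Z : Set E) (u : E → ℝ) : Prop where
  nonneg : ∀ x, 0 ≤ u x
  measurable : Measurable u
  contDiffOn : ContDiffOn ℝ 4 u Zᶜ
  eqn : ∀ x ∈ Zᶜ, Laplacian.laplacian (Laplacian.laplacian u) x = u x ^ p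

/-- The volume of the `ε`-neighbourhoods of `Z` is `O(ε ^ d)`. -/
def HasThinNeighborhoods (d : ℝ) (Z : Set E) : Prop :=
  ∃ C ε₀ : ℝ, 0 < ε₀ ∧ ∀ ε, 0 < ε → ε < ε₀ →
    volume.real (Metric.thickening ε Z) ≤ C * ε ^ d

theorem exists_cutoff_seq {d : ℝ} {Z : Set E} (hZ : IsClosed Z) (hd : HasThinNeighborhoods d Z) :
    ∃ (A C : ℝ) (ε : ℕ → ℝ) (η : ℕ → E → ℝ), 1 ≤ A ∧ Tendsto ε atTop (𝓝 0) ∧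
      (∀ y ∉ Z, ∀ᶠ j in atTop, y ∉ Metric.thickening (ε j) Z) ∧ ∀ j, 0 < ε j ∧ ε j < 1 ∧
      volume.real (Metric.thickening (ε j) Z) ≤ C * ε j ^ d ∧ ContDiff ℝ ∞ (η j) ∧
      (∀ y, 0 ≤ η j y) ∧ (∀ y, η j y ≤ 1) ∧ tsupport (η j) ⊆ Zᶜ ∧
      (∀ y ∉ Metric.thickening (ε j) Z, η j =ᶠ[𝓝 y] fun _ => 1) ∧
      ∀ i, 1 ≤ i → i ≤ 4 → ∀ y, ‖iteratedFDeriv ℝ i (η j) y‖ ≤ (A / ε j) ^ i := by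
  obtain ⟨C, ε₀, hε₀, hC⟩ := hd
  obtain ⟨A, hA, hcut⟩ := exists_cutoff (E := E)
  set e : ℝ := min ε₀ 1
  have he : 0 < e := lt_min hε₀ one_pos
  -- The shift by 2 keeps ε j strictly below min ε₀ 1 already at j = 0.
  set ε : ℕ → ℝ := fun j => e / ((j : ℝ) + 2)
  have hε (j : ℕ) : 0 < ε j := by positivity
  have hεe (j : ℕ) : ε j < e := div_lt_self he (by linarith [(Nat.cast_nonneg j : (0 : ℝ) ≤ j)])
  have hlim : Tendsto ε atTop (𝓝 0) :=
    tendsto_const_nhds.div_atTop (tendsto_atTop_add_const_right _ _ tendsto_natCast_atTop_atTop)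
  choose η h1 h2 h3 h4 h5 h6 using fun j => hcut Z (ε j) (hε j)
  refine ⟨A, C, ε, η, hA, hlim, fun y hy => ?_, fun j => ⟨hε j, (hεe j).trans_le (min_le_right _ _),
    hC _ (hε j) ((hεe j).trans_le (min_le_left _ _)), h1 j, h2 j, h3 j, fun y hy hyZ => ?_, h5 j, h6 j⟩⟩
  · obtain ⟨r, hr, hball⟩ := Metric.isOpen_iff.1 hZ.isOpen_compl y hy
    filter_upwards [hlim.eventually_lt_const hr] with j hj hyj
    obtain ⟨z, hz, hyz⟩ := Metric.mem_thickening_iff.1 hyj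
    exact hball (Metric.mem_ball'.2 (hyz.trans hj)) hz
  · refine notMem_tsupport_iff_eventuallyEq.2 ?_ hy
    filter_upwards [Metric.isOpen_thickening.mem_nhds
      (Metric.self_subset_thickening (by linarith [hε j] : 0 < ε j / 4) Z hyZ)] with w hw
    exact h4 j w hw

theorem HasThinNeighborhoods.measure_zero {d : ℝ} {Z : Set E} (hZ : IsCompact Z) (hd0 : 0 < d)
    (hd : HasThinNeighborhoods d Z) : volume Z = 0 := by
  obtain ⟨C, ε₀, hε₀, hC⟩ := hd
  have h1 : ∀ᶠ ε : ℝ in 𝓝[>] 0, volume.real Z ≤ C * ε ^ d := by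
    filter_upwards [Ioo_mem_nhdsGT hε₀] with ε hε
    refine (measureReal_mono (Metric.self_subset_thickening hε.1 Z) ?_).trans (hC ε hε.1 hε.2)
    exact hZ.isBounded.thickening.measure_lt_top.ne
  have h2 : Tendsto (fun ε : ℝ => C * ε ^ d) (𝓝[>] 0) (𝓝 0) := by
    have : Tendsto (fun ε : ℝ => C * ε ^ d) (𝓝 0) (𝓝 (C * 0 ^ d)) :=
      ((Real.continuous_rpow_const hd0.le).tendsto 0).const_mul C
    rw [Real.zero_rpow hd0.ne', mul_zero] at this
    exact this.mono_left nhdsWithin_le_nhds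
  have h3 : volume.real Z ≤ 0 := ge_of_tendsto h2 h1
  have h4 := le_antisymm h3 measureReal_nonneg
  rwa [measureReal_eq_zero_iff hZ.measure_lt_top.ne] at h4

variable {p q : ℝ} {Z : Set E} {u : E → ℝ}

theorem IsNonnegPuncturedSolution.integral_rpow_mul (hu : IsNonnegPuncturedSolution p Z u)
    (hp : 0 ≤ p) (hZ : IsClosed Z) {ψ : E → ℝ} (hψ : ContDiff ℝ 4 ψ) (hc : HasCompactSupport ψ)
    (hψZ : tsupport ψ ⊆ Zᶜ) :
    Integrable (fun x => u x ^ p * ψ x) ∧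
    Integrable (fun x => u x * Laplacian.laplacian (Laplacian.laplacian ψ) x) ∧
    ∫ x, u x ^ p * ψ x = ∫ x, u x * Laplacian.laplacian (Laplacian.laplacian ψ) x := by
  have hΔ : Continuous (Laplacian.laplacian (Laplacian.laplacian ψ)) :=
    (contDiff_iff_contDiffAt.2 fun x => (hψ.contDiffAt.laplacian (m := 2) (by norm_num)).laplacian
      (m := 0) (by norm_num)).continuous
  refine ⟨integrable_mul_of_tsupport_subset
    (hu.contDiffOn.continuousOn.rpow_const fun _ _ => Or.inr hp) hψ.continuous hc hψZ,
    integrable_mul_of_tsupport_subset hu.contDiffOn.continuousOn hΔ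
      (hc.of_isClosed_subset (isClosed_tsupport _) (tsupport_bilaplacian_subset ψ))
      ((tsupport_bilaplacian_subset ψ).trans hψZ), ?_⟩
  rw [← integral_bilaplacian_mul hZ.isOpen_compl hu.contDiffOn hψ hc hψZ]
  refine integral_congr_ae (Eventually.of_forall fun x => ?_)
  by_cases hx : x ∈ tsupport ψ
  · simp [hu.eqn x (hψZ hx)]
  · simp [image_eq_zero_of_notMem_tsupport hx]

/-- Absorption with ξ = ηχ, where η cuts off near Z and χ near infinity. The contribution of the
ε-neighbourhood is (ε^(-4))^q times its volume O(ε^(4q)), hence bounded uniformly in ε. -/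
theorem IsNonnegPuncturedSolution.integrableOn_rpow (hu : IsNonnegPuncturedSolution p Z u)
    (hpq : p.HolderConjugate q) (hZ : IsCompact Z) (hthin : HasThinNeighborhoods (4 * q) Z)
    (x : E) (R : ℝ) : IntegrableOn (fun y => u y ^ p) (Metric.closedBall x R) := by
  obtain ⟨A, C, ε, η, hA, hε0, hout, H⟩ := exists_cutoff_seq hZ.isClosed hthin
  obtain ⟨B, hB1, hB⟩ := exists_norm_iteratedFDeriv_ballCutoff_le (E := E)
  -- R₂ is taken so large that χ = 1 on the 1-neighbourhood of Z. Then ξ agrees locally with η on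
  -- the ε-neighbourhood and with χ off it, and no mixed derivatives arise.
  obtain ⟨R₁, hR₁⟩ := (hZ.isBounded.thickening (δ := 1)).subset_ball x
  obtain ⟨R₂, hR₂, hRR, hRR₁⟩ : ∃ R₂ : ℝ, 0 < R₂ ∧ R ≤ R₂ ∧ R₁ ≤ R₂ :=
    ⟨max 1 (max R R₁), by positivity, by simp, by simp⟩
  obtain ⟨m, hm4, hm⟩ : ∃ m : ℕ, 4 < m ∧ 4 * q ≤ m := by
    obtain ⟨k, hk⟩ := exists_nat_ge (4 * q)
    exact ⟨k + 5, by omega, by push_cast; linarith⟩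
  set χ : E → ℝ := ballCutoff R₂ x
  have hχs : ContDiff ℝ ∞ χ := contDiff_ballCutoff R₂ x
  set K : ℝ := bilaplacianBound E * 24 * (m : ℝ) ^ 4
  have hK : 0 ≤ K := mul_nonneg (mul_nonneg bilaplacianBound_nonneg (by norm_num)) (by positivity)
  set V := volume.real (Metric.closedBall x (2 * R₂))
  -- The first term comes from the ε-neighbourhood of Z, after the powers of ε have cancelled; the
  -- second from the cutoff at scale R₂.
  set bd : ℝ := (K * A ^ 4) ^ q * C + (K * (B / R₂) ^ 4) ^ q * V
  have hthick (j : ℕ) : Metric.thickening (ε j) Z ⊆ Metric.ball x R₂ :=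
    (Metric.thickening_mono (H j).2.1.le Z).trans (hR₁.trans (Metric.ball_subset_ball hRR₁))
  have hbound (j : ℕ) : Integrable (fun y => u y ^ p * (η j y * χ y) ^ m) ∧
      ∫ y, u y ^ p * (η j y * χ y) ^ m ≤ bd := by
    obtain ⟨hεp, hε1, hvol, hηs, hη0, hη1, hηZ, hηe, hηd⟩ := H j
    set ξ : E → ℝ := fun y => η j y * χ y
    have hξs : ContDiff ℝ 4 ξ := mod_cast contDiff_infty.1 (hηs.mul hχs) 4
    have hξ0 (y : E) : 0 ≤ ξ y := mul_nonneg (hη0 y) (ballCutoff_nonneg _ _ _)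
    have hξ1 (y : E) : ξ y ≤ 1 := mul_le_one₀ (hη1 y) (ballCutoff_nonneg _ _ _) (ballCutoff_le_one _ _ _)
    have hpow : tsupport (fun y => ξ y ^ m) ⊆ tsupport ξ :=
      closure_minimal (fun y hy => subset_tsupport ξ fun h0 => hy (by
        change ξ y ^ m = 0; rw [h0, zero_pow (by omega)])) (isClosed_tsupport ξ)
    have hξZ : tsupport ξ ⊆ Zᶜ := (tsupport_mul_subset_left (f := η j) (g := χ)).trans hηZ
    have hξc : HasCompactSupport ξ := (hasCompactSupport_ballCutoff hR₂ x).mul_left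
    have hψ := hu.integral_rpow_mul hpq.nonneg hZ.isClosed (hξs.pow m)
      (hξc.of_isClosed_subset (isClosed_tsupport _) hpow) (hpow.trans hξZ)
    refine ⟨hψ.1, ?_⟩
    classical
    set T := Metric.thickening (ε j) Z
    set S := Metric.closedBall x (2 * R₂)
    have hTm : MeasurableSet T := Metric.isOpen_thickening.measurableSet
    have hSm : MeasurableSet S := Metric.isClosed_closedBall.measurableSet
    have hTf : volume T ≠ ⊤ := hZ.isBounded.thickening.measure_lt_top.ne
    have hSf : volume S ≠ ⊤ := measure_closedBall_lt_top.ne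
    set a : ℝ := K * (A / ε j) ^ 4
    set b : ℝ := K * (B / R₂) ^ 4
    have ha : 0 ≤ a := by positivity
    have hb : 0 ≤ b := by positivity
    set G : E → ℝ := fun y => if y ∈ T then a else if y ∈ S then b else 0
    have hGq : (fun y => G y ^ q) =
        fun y => T.indicator (fun _ => a ^ q) y + (S \ T).indicator (fun _ => b ^ q) y := by
      ext y
      by_cases h1 : y ∈ T
      · simp [G, h1]
      · by_cases h2 : y ∈ S
        · simp [G, h1, h2]
        · simp [G, h1, h2, Real.zero_rpow hpq.symm.ne_zero]
    have hi1 : Integrable (T.indicator fun _ : E => a ^ q) :=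
      (integrable_indicator_iff hTm).2 (integrableOn_const hTf)
    have hi2 : Integrable ((S \ T).indicator fun _ : E => b ^ q) :=
      (integrable_indicator_iff (hSm.diff hTm)).2
        ((integrableOn_const hSf).mono_set sdiff_subset)
    have hL (y : E) : Laplacian.laplacian (Laplacian.laplacian fun y => ξ y ^ m) y ≤
        ξ y ^ (m - 4) * G y := by
      refine (le_abs_self _).trans ?_
      by_cases h1 : y ∈ T
      · have he : ξ =ᶠ[𝓝 y] η j := by
          filter_upwards [Metric.isOpen_ball.mem_nhds (hthick j h1)] with w hw
          change η j w * χ w = η j w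
          rw [show χ w = 1 from ballCutoff_eq_one hR₂ (Metric.mem_ball.1 hw).le, mul_one]
        have := abs_bilaplacian_pow_le hξs (hξ0 y) (hξ1 y) hm4.le (D := A / ε j) fun i hi1 hi4 => by
          rw [(he.iteratedFDeriv ℝ i).self_of_nhds]; exact hηd i hi1 hi4 y
        simpa [G, h1] using this
      · have he : ξ =ᶠ[𝓝 y] χ := by
          filter_upwards [hηe y h1] with w hw
          change η j w * χ w = χ w
          rw [hw, one_mul]
        have := abs_bilaplacian_pow_le hξs (hξ0 y) (hξ1 y) hm4.le (D := B / R₂) fun i hi1 hi4 => by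
          rw [(he.iteratedFDeriv ℝ i).self_of_nhds]; exact hB R₂ x hR₂ i hi1 hi4 y
        by_cases h2 : y ∈ S
        · simpa [G, h1, h2] using this
        · have h0 : ξ y = 0 := by
            rw [he.self_of_nhds]
            exact ballCutoff_eq_zero hR₂ (not_le.1 h2).le
          rw [h0, zero_pow (by omega), zero_mul] at this ⊢
          exact this
    have key := integral_rpow_mul_pow_le hpq hm4 hm hu.nonneg hξ0 hξ1
      (fun y => by simp only [G]; split_ifs <;> first | assumption | exact le_rfl)
      hL hψ.1 hψ.2.1 (by rw [hGq]; exact hi1.add hi2) hψ.2.2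
    refine key.trans ?_
    rw [hGq, integral_add hi1 hi2, integral_indicator_const _ hTm,
      integral_indicator_const _ (hSm.diff hTm), smul_eq_mul, smul_eq_mul]
    have e1 : volume.real T * a ^ q ≤ (K * A ^ 4) ^ q * C := by
      have e2 : a ^ q = (K * A ^ 4) ^ q * (ε j ^ (4 * q))⁻¹ := by
        rw [show a = (K * A ^ 4) * (ε j ^ 4)⁻¹ by simp only [a]; field_simp,
          Real.mul_rpow (by positivity) (by positivity), Real.inv_rpow (by positivity),
          Real.rpow_mul hεp.le]
        norm_cast
      rw [e2]
      calc volume.real T * ((K * A ^ 4) ^ q * (ε j ^ (4 * q))⁻¹)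
          ≤ (C * ε j ^ (4 * q)) * ((K * A ^ 4) ^ q * (ε j ^ (4 * q))⁻¹) := by gcongr
        _ = (K * A ^ 4) ^ q * C := by
          have : ε j ^ (4 * q) ≠ 0 := (Real.rpow_pos_of_pos hεp _).ne'
          field_simp
    have e3 : volume.real (S \ T) * b ^ q ≤ (K * (B / R₂) ^ 4) ^ q * V := by
      rw [mul_comm]
      exact mul_le_mul_of_nonneg_left (measureReal_mono sdiff_subset hSf) (by positivity)
    exact add_le_add e1 e3
  have hZ0 := hthin.measure_zero hZ (by linarith [hpq.symm.pos])
  have hfin := (integrable_and_tendsto_of_le_of_integral_le (f := fun y => u y ^ p * χ y ^ m)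
    (fun j => (hbound j).1)
    (fun j => Eventually.of_forall fun y => mul_nonneg (Real.rpow_nonneg (hu.nonneg y) p)
      (pow_nonneg (mul_nonneg ((H j).2.2.2.2.1 y) (ballCutoff_nonneg _ _ _)) m))
    (fun j => Eventually.of_forall fun y => by
      have h1 := (H j).2.2.2.2.1 y
      have h2 := (H j).2.2.2.2.2.1 y
      have h3 : 0 ≤ χ y := ballCutoff_nonneg _ _ _
      have h4 := Real.rpow_nonneg (hu.nonneg y) p
      gcongr
      exact mul_le_of_le_one_left h3 h2)
    (by
      filter_upwards [measure_eq_zero_iff_ae_notMem.1 hZ0] with y hy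
      refine tendsto_const_nhds.congr' ?_
      filter_upwards [hout y hy] with j hj
      rw [((H j).2.2.2.2.2.2.2.1 y hj).self_of_nhds, one_mul])
    (fun j => (hbound j).2)).1
  refine (hfin.integrableOn (s := Metric.closedBall x R)).congr_fun (fun y hy => ?_)
    Metric.isClosed_closedBall.measurableSet
  have : χ y = 1 := ballCutoff_eq_one hR₂ ((Metric.mem_closedBall.1 hy).trans hRR)
  simp [this]

end Removability

/-! ### The distributional equation on the whole space, and growth at infinity -/

section WeakEquation

variable {E : Type} [NormedAddCommGroup E] [InnerProductSpace ℝ E] [FiniteDimensional ℝ E]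

theorem continuous_bilaplacian {f : E → ℝ} (hf : ContDiff ℝ 4 f) :
    Continuous (Laplacian.laplacian (Laplacian.laplacian f)) :=
  (contDiff_iff_contDiffAt.2 fun _ => (hf.contDiffAt.laplacian (m := 2) (by norm_num)).laplacian
    (m := 0) (by norm_num)).continuous

theorem hasCompactSupport_bilaplacian {f : E → ℝ} (hf : HasCompactSupport f) :
    HasCompactSupport (Laplacian.laplacian (Laplacian.laplacian f)) :=
  hf.of_isClosed_subset (isClosed_tsupport _) (tsupport_bilaplacian_subset f)

/-- Leibniz rule: 16 is the sum of the binomial coefficients of order 4, and D ≥ 1 bounds every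
derivative of g by D^4. -/
theorem abs_bilaplacian_mul_le {f g : E → ℝ} (hf : ContDiff ℝ 4 f) (hg : ContDiff ℝ 4 g) {x : E}
    {B D : ℝ} (hD : 1 ≤ D) (hB : ∀ i ≤ 4, ‖iteratedFDeriv ℝ i f x‖ ≤ B)
    (h0 : ‖g x‖ ≤ 1) (hgD : ∀ i, 1 ≤ i → i ≤ 4 → ‖iteratedFDeriv ℝ i g x‖ ≤ D ^ i) :
    |Laplacian.laplacian (Laplacian.laplacian fun y => f y * g y) x| ≤
      bilaplacianBound E * (16 * B * D ^ 4) := by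
  refine (abs_bilaplacian_le (hf.mul hg).contDiffAt).trans
    (mul_le_mul_of_nonneg_left ?_ bilaplacianBound_nonneg)
  refine (norm_iteratedFDeriv_mul_le hf hg x (n := 4) le_rfl).trans ?_
  have hgD' (i : ℕ) (hi : i ≤ 4) : ‖iteratedFDeriv ℝ i g x‖ ≤ D ^ 4 := by
    rcases Nat.eq_zero_or_pos i with rfl | hi0
    · rw [norm_iteratedFDeriv_zero]; exact h0.trans (one_le_pow₀ hD)
    · exact (hgD i hi0 hi).trans (pow_le_pow_right₀ hD hi)
  have hB0 : 0 ≤ B := (norm_nonneg _).trans (hB 0 (by norm_num))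
  calc ∑ i ∈ Finset.range (4 + 1), ((4 : ℕ).choose i : ℝ) * ‖iteratedFDeriv ℝ i f x‖ *
        ‖iteratedFDeriv ℝ (4 - i) g x‖
      ≤ ∑ i ∈ Finset.range (4 + 1), ((4 : ℕ).choose i : ℝ) * B * D ^ 4 := by
        refine Finset.sum_le_sum fun i hi => ?_
        have hi4 : i ≤ 4 := by have := Finset.mem_range.1 hi; omega
        gcongr
        · exact hB i hi4
        · exact hgD' _ (by omega)
    _ = 16 * B * D ^ 4 := by
        rw [← Finset.sum_mul, ← Finset.sum_mul]
        norm_num [Finset.sum_range_succ, Nat.choose]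

variable [MeasurableSpace E] [BorelSpace E]

variable {p q : ℝ} {Z : Set E} {u : E → ℝ}

theorem integrable_mul_of_integrableOn_closedBall {f g : E → ℝ}
    (hf : ∀ R, IntegrableOn f (Metric.closedBall 0 R)) (hg : Continuous g)
    (hc : HasCompactSupport g) : Integrable (fun x => f x * g x) := by
  obtain ⟨R, hR⟩ := hc.isCompact.isBounded.subset_closedBall (0 : E)
  have h1 : IntegrableOn (fun x => f x * g x) (tsupport g) :=
    ((hf R).mono_set hR).mul_continuousOn hg.continuousOn hc
  rwa [integrableOn_iff_integrable_of_support_subset] at h1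
  exact fun x hx => subset_tsupport g (fun h0 => hx (by simp [h0]))

theorem IsNonnegPuncturedSolution.integrableOn (hu : IsNonnegPuncturedSolution p Z u)
    (hpq : p.HolderConjugate q) (hZ : IsCompact Z) (hthin : HasThinNeighborhoods (4 * q) Z)
    (x : E) (R : ℝ) : IntegrableOn u (Metric.closedBall x R) :=
  integrableOn_of_rpow hpq.lt.le hu.measurable hu.nonneg measure_closedBall_lt_top.ne
    (hu.integrableOn_rpow hpq hZ hthin x R)

/-- The singular set is removable: the equation holds in the sense of distributions. -/
theorem IsNonnegPuncturedSolution.integral_rpow_mul_eq (hu : IsNonnegPuncturedSolution p Z u)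
    (hpq : p.HolderConjugate q) (hZ : IsCompact Z) (hthin : HasThinNeighborhoods (4 * q) Z)
    {φ : E → ℝ} (hφ : ContDiff ℝ ∞ φ) (hc : HasCompactSupport φ) :
    Integrable (fun x => u x ^ p * φ x) ∧
    Integrable (fun x => u x * Laplacian.laplacian (Laplacian.laplacian φ) x) ∧
    ∫ x, u x ^ p * φ x = ∫ x, u x * Laplacian.laplacian (Laplacian.laplacian φ) x := by
  have hφ4 : ContDiff ℝ 4 φ := mod_cast contDiff_infty.1 hφ 4
  have hiL : Integrable (fun x => u x ^ p * φ x) :=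
    integrable_mul_of_integrableOn_closedBall (hu.integrableOn_rpow hpq hZ hthin 0) hφ.continuous hc
  have hiR : Integrable (fun x => u x * Laplacian.laplacian (Laplacian.laplacian φ) x) :=
    integrable_mul_of_integrableOn_closedBall (hu.integrableOn hpq hZ hthin 0)
      (continuous_bilaplacian hφ4) (hasCompactSupport_bilaplacian hc)
  refine ⟨hiL, hiR, ?_⟩
  obtain ⟨A, C, ε, η, hA, hε0, hout, H⟩ := exists_cutoff_seq hZ.isClosed hthin
  obtain ⟨B, hB1, hB⟩ := exists_norm_iteratedFDeriv_le hφ hc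
  have hZ0 := hthin.measure_zero hZ (by linarith [hpq.symm.pos])
  set T : ℕ → Set E := fun j => Metric.thickening (ε j) Z
  have hTm (j : ℕ) : MeasurableSet (T j) := Metric.isOpen_thickening.measurableSet
  have hTf (j : ℕ) : volume (T j) ≠ ⊤ := hZ.isBounded.thickening.measure_lt_top.ne
  obtain ⟨R, hR⟩ := (hZ.isBounded.thickening (δ := 1)).subset_closedBall (0 : E)
  have hT1 (j : ℕ) : T j ⊆ Metric.closedBall 0 R := (Metric.thickening_mono (H j).2.1.le Z).trans hR
  have hweak (j : ℕ) := hu.integral_rpow_mul hpq.nonneg hZ.isClosed (ψ := fun y => φ y * η j y)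
    (mod_cast contDiff_infty.1 (hφ.mul (H j).2.2.2.1) 4) hc.mul_right
    ((tsupport_mul_subset_right (f := φ) (g := η j)).trans (H j).2.2.2.2.2.2.1)
  have lim1 : Tendsto (fun j => ∫ x, u x ^ p * (φ x * η j x)) atTop (𝓝 (∫ x, u x ^ p * φ x)) := by
    refine tendsto_integral_of_dominated_convergence (fun x => ‖u x ^ p * φ x‖)
      (fun j => (hweak j).1.aestronglyMeasurable) hiL.norm
      (fun j => Eventually.of_forall fun x => ?_) ?_
    · obtain ⟨-, -, -, -, h0, h1, -⟩ := H j
      rw [← mul_assoc, norm_mul]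
      exact mul_le_of_le_one_right (norm_nonneg _) (by rw [Real.norm_of_nonneg (h0 x)]; exact h1 x)
    · filter_upwards [measure_eq_zero_iff_ae_notMem.1 hZ0] with y hy
      refine tendsto_const_nhds.congr' ?_
      filter_upwards [hout y hy] with j hj
      rw [((H j).2.2.2.2.2.2.2.1 y hj).self_of_nhds, mul_one]
  have lim2 : Tendsto (fun j => ∫ x in T j, u x ^ p) atTop (𝓝 0) := by
    have h1 := tendsto_integral_of_dominated_convergence (μ := volume)
      (F := fun j => (T j).indicator fun x => u x ^ p) (f := fun _ => (0 : ℝ))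
      ((Metric.closedBall 0 R).indicator fun x => u x ^ p)
      (fun j => ((hu.measurable.pow_const p).indicator (hTm j)).aestronglyMeasurable)
      ((integrable_indicator_iff Metric.isClosed_closedBall.measurableSet).2
        (hu.integrableOn_rpow hpq hZ hthin 0 R))
      (fun j => Eventually.of_forall fun x => by
        rw [Real.norm_of_nonneg (indicator_nonneg (fun x _ => Real.rpow_nonneg (hu.nonneg x) p) x)]
        exact indicator_le_indicator_of_subset (hT1 j)
          (fun x => Real.rpow_nonneg (hu.nonneg x) p) x) (by
        filter_upwards [measure_eq_zero_iff_ae_notMem.1 hZ0] with y hy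
        refine tendsto_const_nhds.congr' ?_
        filter_upwards [hout y hy] with j hj
        rw [indicator_of_notMem hj])
    simpa only [integral_indicator (hTm _), integral_zero] using h1
  -- 32 = 16 + 16: one 16 from the Leibniz bound for φη, the other from bounding the bilaplacian of
  -- φ crudely by the same quantity.
  set M : ℝ := bilaplacianBound E * (32 * B * A ^ 4)
  have hM : 0 ≤ M := mul_nonneg bilaplacianBound_nonneg (by positivity)
  -- The two bilaplacians agree off T j, so only the integral of u over T j enters; Hölder turns it
  -- into a vanishing integral of u^p.
  have hdiff (j : ℕ) : ‖(∫ x, u x * Laplacian.laplacian (Laplacian.laplacian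
      fun y => φ y * η j y) x) - ∫ x, u x * Laplacian.laplacian (Laplacian.laplacian φ) x‖ ≤
      M * |C| ^ (1 / q) * (∫ x in T j, u x ^ p) ^ (1 / p) := by
    obtain ⟨hεp, hε1, hvol, hηs, hη0, hη1, hηZ, hηe, hηd⟩ := H j
    rw [← integral_sub (hweak j).2.1 hiR]
    have hAε : 1 ≤ A / ε j := (one_le_div hεp).2 (hε1.le.trans hA)
    have hpt (x : E) : ‖u x * Laplacian.laplacian (Laplacian.laplacian fun y => φ y * η j y) x -
        u x * Laplacian.laplacian (Laplacian.laplacian φ) x‖ ≤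
        (T j).indicator (fun x => M / ε j ^ 4 * u x) x := by
      by_cases hx : x ∈ T j
      · rw [indicator_of_mem hx, ← mul_sub, norm_mul, Real.norm_of_nonneg (hu.nonneg x), mul_comm]
        refine mul_le_mul_of_nonneg_right ?_ (hu.nonneg x)
        have e1 := abs_bilaplacian_mul_le hφ4 (mod_cast contDiff_infty.1 hηs 4) (x := x) hAε
          (fun i hi => hB i hi x) (by rw [Real.norm_of_nonneg (hη0 x)]; exact hη1 x)
          (fun i h1 h4 => hηd i h1 h4 x)
        have e2 := (abs_bilaplacian_le (x := x) hφ4.contDiffAt).trans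
          (mul_le_mul_of_nonneg_left (hB 4 le_rfl x) bilaplacianBound_nonneg)
        have e3 : bilaplacianBound E * B ≤ bilaplacianBound E * (16 * B * (A / ε j) ^ 4) := by
          refine mul_le_mul_of_nonneg_left ?_ bilaplacianBound_nonneg
          nlinarith [one_le_pow₀ hAε (n := 4)]
        rw [Real.norm_eq_abs]
        refine (abs_sub _ _).trans ?_
        calc _ ≤ _ := add_le_add e1 (e2.trans e3)
          _ = M / ε j ^ 4 := by simp only [M]; field_simp; ring
      · have : (fun y => φ y * η j y) =ᶠ[𝓝 x] φ := by
          filter_upwards [hηe x hx] with w hw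
          rw [hw, mul_one]
        rw [bilaplacian_congr this, sub_self, norm_zero, indicator_of_notMem hx]
    have hTi : IntegrableOn u (T j) := (hu.integrableOn hpq hZ hthin 0 R).mono_set (hT1 j)
    have h1 := norm_integral_le_of_norm_le
      ((integrable_indicator_iff (hTm j)).2 (hTi.const_mul (M / ε j ^ 4)))
      (Eventually.of_forall hpt)
    refine h1.trans ?_
    rw [integral_indicator (hTm j), integral_const_mul]
    have h2 := setIntegral_le_rpow_mul_measure_rpow hpq hu.measurable hu.nonneg (hTf j)
      ((hu.integrableOn_rpow hpq hZ hthin 0 R).mono_set (hT1 j))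
    -- The critical balance: the volume exponent 4q is just enough to compensate the factor ε^(-4).
    have h3 : (volume.real (T j)) ^ (1 / q) ≤ |C| ^ (1 / q) * ε j ^ 4 := by
      have : volume.real (T j) ≤ |C| * ε j ^ (4 * q) :=
        hvol.trans (mul_le_mul_of_nonneg_right (le_abs_self C) (by positivity))
      refine (Real.rpow_le_rpow measureReal_nonneg this hpq.symm.one_div_nonneg).trans ?_
      rw [Real.mul_rpow (abs_nonneg C) (by positivity), ← Real.rpow_mul hεp.le,
        mul_assoc, mul_one_div_cancel hpq.symm.ne_zero, mul_one]
      norm_cast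
    have h4 : 0 ≤ (∫ x in T j, u x ^ p) ^ (1 / p) :=
      Real.rpow_nonneg (integral_nonneg fun x => Real.rpow_nonneg (hu.nonneg x) p) _
    calc M / ε j ^ 4 * ∫ x in T j, u x
        ≤ M / ε j ^ 4 * ((∫ x in T j, u x ^ p) ^ (1 / p) * (|C| ^ (1 / q) * ε j ^ 4)) := by
          gcongr
          exact h2.trans (mul_le_mul_of_nonneg_left h3 h4)
      _ = M * |C| ^ (1 / q) * (∫ x in T j, u x ^ p) ^ (1 / p) := by field_simp
  have lim3 : Tendsto (fun j => ∫ x, u x * Laplacian.laplacian (Laplacian.laplacian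
      fun y => φ y * η j y) x) atTop
      (𝓝 (∫ x, u x * Laplacian.laplacian (Laplacian.laplacian φ) x)) := by
    rw [tendsto_iff_norm_sub_tendsto_zero]
    refine squeeze_zero (fun _ => norm_nonneg _) hdiff ?_
    have := (lim2.rpow_const (p := 1 / p) (Or.inr hpq.one_div_nonneg)).const_mul (M * |C| ^ (1 / q))
    rwa [Real.zero_rpow hpq.one_div_ne_zero, mul_zero] at this
  refine tendsto_nhds_unique lim1 (lim3.congr fun j => ((hweak j).2.2).symm)

/-- With Z removed, a power of the ball cutoff alone is an admissible test function, and absorption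
leaves (R^(-4))^q · R^N. -/
theorem IsNonnegPuncturedSolution.setIntegral_rpow_le (hu : IsNonnegPuncturedSolution p Z u)
    (hpq : p.HolderConjugate q) (hZ : IsCompact Z) (hthin : HasThinNeighborhoods (4 * q) Z)
    (x : E) : ∃ C : ℝ, 0 ≤ C ∧ ∀ R, 0 < R → ∫ y in Metric.closedBall x R, u y ^ p ≤
      C * R ^ ((Module.finrank ℝ E : ℝ) - 4 * q) := by
  obtain ⟨B, hB1, hB⟩ := exists_norm_iteratedFDeriv_ballCutoff_le (E := E)
  obtain ⟨m, hm4, hm⟩ : ∃ m : ℕ, 4 < m ∧ 4 * q ≤ m := by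
    obtain ⟨k, hk⟩ := exists_nat_ge (4 * q)
    exact ⟨k + 5, by omega, by push_cast; linarith⟩
  set K : ℝ := bilaplacianBound E * 24 * (m : ℝ) ^ 4
  have hK : 0 ≤ K :=
    mul_nonneg (mul_nonneg bilaplacianBound_nonneg (by norm_num)) (by positivity)
  set V := volume.real (Metric.ball (0 : E) 1)
  refine ⟨(K * B ^ 4) ^ q * (2 ^ Module.finrank ℝ E * V), by positivity, fun R hR => ?_⟩
  set χ : E → ℝ := ballCutoff R x
  have hχs : ContDiff ℝ 4 χ := mod_cast contDiff_infty.1 (contDiff_ballCutoff R x) 4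
  have hpow : tsupport (fun y => χ y ^ m) ⊆ tsupport χ :=
    closure_minimal (fun y hy => subset_tsupport χ fun h0 => hy (by
      change χ y ^ m = 0; rw [h0, zero_pow (by omega)])) (isClosed_tsupport χ)
  have hψ := hu.integral_rpow_mul_eq hpq hZ hthin ((contDiff_ballCutoff R x).pow m)
    ((hasCompactSupport_ballCutoff hR x).of_isClosed_subset (isClosed_tsupport _) hpow)
  set S := Metric.closedBall x (2 * R)
  have hSm : MeasurableSet S := Metric.isClosed_closedBall.measurableSet
  have hSf : volume S ≠ ⊤ := measure_closedBall_lt_top.ne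
  set b : ℝ := K * (B / R) ^ 4
  have hb : 0 ≤ b := by positivity
  have hGq : (fun y => (S.indicator (fun _ => b) y) ^ q) = S.indicator (fun _ => b ^ q) := by
    ext y
    by_cases h2 : y ∈ S
    · simp [h2]
    · simp [h2, Real.zero_rpow hpq.symm.ne_zero]
  have key := integral_rpow_mul_pow_le hpq hm4 hm hu.nonneg (ξ := χ) (G := S.indicator fun _ => b)
    (fun y => ballCutoff_nonneg _ _ _) (fun y => ballCutoff_le_one _ _ _)
    (fun y => indicator_nonneg (fun _ _ => hb) y) (fun y => by
      have := (le_abs_self _).trans (abs_bilaplacian_pow_le hχs (ballCutoff_nonneg _ _ _)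
        (ballCutoff_le_one _ _ _) hm4.le (hB R x hR · · · y))
      by_cases h2 : y ∈ S
      · simpa [h2] using this
      · have h0 : χ y = 0 := ballCutoff_eq_zero hR (not_le.1 h2).le
        rw [h0, zero_pow (by omega), zero_mul] at this ⊢
        exact this) hψ.1 hψ.2.1
    (by rw [hGq]; exact (integrable_indicator_iff hSm).2 (integrableOn_const hSf)) hψ.2.2
  rw [hGq, integral_indicator_const _ hSm, smul_eq_mul,
    Measure.addHaar_real_closedBall _ _ (by positivity)] at key
  have h1 : ∫ y in Metric.closedBall x R, u y ^ p ≤ ∫ y, u y ^ p * χ y ^ m := by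
    rw [← integral_indicator Metric.isClosed_closedBall.measurableSet]
    refine integral_mono ((integrable_indicator_iff Metric.isClosed_closedBall.measurableSet).2
        (hu.integrableOn_rpow hpq hZ hthin x R)) hψ.1 fun y => ?_
    have h0 := Real.rpow_nonneg (hu.nonneg y) p
    by_cases hy : y ∈ Metric.closedBall x R
    · have h1 : χ y = 1 := ballCutoff_eq_one hR (Metric.mem_closedBall.1 hy)
      simp [hy, h1]
    · simp only [hy, not_false_eq_true, indicator_of_notMem]
      exact mul_nonneg h0 (pow_nonneg (ballCutoff_nonneg _ _ _) m)
  refine h1.trans (key.trans_eq ?_)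
  have e2 : b ^ q = (K * B ^ 4) ^ q * (R ^ (4 * q))⁻¹ := by
    rw [show b = (K * B ^ 4) * (R ^ 4)⁻¹ by simp only [b]; field_simp,
      Real.mul_rpow (by positivity) (by positivity), Real.inv_rpow (by positivity),
      Real.rpow_mul hR.le]
    norm_cast
  rw [e2, Real.rpow_sub hR, Real.rpow_natCast, mul_pow]
  ring

/-- Hölder and the growth bound give the exponent (n - 4q)/p + n/q - n = -4q/p < 0. This is what
rules out an extra biharmonic term in the representation formula. -/
theorem IsNonnegPuncturedSolution.tendsto_average (hu : IsNonnegPuncturedSolution p Z u)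
    (hpq : p.HolderConjugate q) (hZ : IsCompact Z) (hthin : HasThinNeighborhoods (4 * q) Z)
    (x : E) : Tendsto (fun R : ℝ => (R ^ Module.finrank ℝ E)⁻¹ *
      ∫ y in Metric.closedBall x (2 * R), u y) atTop (𝓝 0) := by
  obtain ⟨C, hC0, hC⟩ := hu.setIntegral_rpow_le hpq hZ hthin x
  set n := Module.finrank ℝ E
  set V := volume.real (Metric.ball (0 : E) 1)
  set M : ℝ := C ^ (1 / p) * 2 ^ (((n : ℝ) - 4 * q) * (1 / p)) * ((2 ^ n * V) ^ (1 / q))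
  have hlim : Tendsto (fun R : ℝ => M * R ^ (-(4 * q * (1 / p)))) atTop (𝓝 0) := by
    have := (tendsto_rpow_neg_atTop (y := 4 * q * (1 / p))
      (mul_pos (by linarith [hpq.symm.pos]) hpq.one_div_pos)).const_mul M
    rwa [mul_zero] at this
  refine squeeze_zero' ?_ ?_ hlim
  · filter_upwards [eventually_gt_atTop 0] with R hR
    exact mul_nonneg (by positivity) (integral_nonneg fun y => hu.nonneg y)
  · filter_upwards [eventually_gt_atTop 0] with R hR
    have h1 := setIntegral_le_rpow_mul_measure_rpow hpq hu.measurable hu.nonneg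
      measure_closedBall_lt_top.ne (hu.integrableOn_rpow hpq hZ hthin x (2 * R))
    have h2 := hC (2 * R) (by positivity)
    rw [Measure.addHaar_real_closedBall _ _ (by positivity)] at h1
    have h3 := Real.rpow_le_rpow (integral_nonneg fun x => Real.rpow_nonneg (hu.nonneg x) p) h2
      hpq.one_div_nonneg
    have hVn : 0 ≤ V := measureReal_nonneg
    have h4 : ∫ y in Metric.closedBall x (2 * R), u y ≤
        (C * (2 * R) ^ ((n : ℝ) - 4 * q)) ^ (1 / p) * ((2 * R) ^ n * V) ^ (1 / q) :=
      h1.trans (mul_le_mul_of_nonneg_right h3 (by positivity))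
    have h5 : (C * (2 * R) ^ ((n : ℝ) - 4 * q)) ^ (1 / p) * ((2 * R) ^ n * V) ^ (1 / q) =
        M * (R ^ n * R ^ (-(4 * q * (1 / p)))) := by
      rw [mul_pow, mul_right_comm (2 ^ n), Real.mul_rpow hC0 (by positivity),
        Real.mul_rpow (by positivity) (by positivity) (x := 2 ^ n * V), Real.mul_rpow zero_le_two hR.le,
        Real.mul_rpow (by positivity) (by positivity),
        ← Real.rpow_mul zero_le_two, ← Real.rpow_mul hR.le, ← Real.rpow_natCast R n,
        ← Real.rpow_mul hR.le, ← Real.rpow_add hR]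
      have : (n : ℝ) + -(4 * q * (1 / p)) = ((n : ℝ) - 4 * q) * (1 / p) + n * (1 / q) := by
        have h6 : 1 / q = 1 - 1 / p := by
          rw [one_div, one_div, hpq.one_sub_inv]
        rw [h6]; ring
      rw [this, Real.rpow_add hR]
      simp only [M]
      ring
    calc (R ^ n)⁻¹ * ∫ y in Metric.closedBall x (2 * R), u y
        ≤ (R ^ n)⁻¹ * (M * (R ^ n * R ^ (-(4 * q * (1 / p))))) := by
          rw [← h5]; gcongr
      _ = M * R ^ (-(4 * q * (1 / p))) := by field_simp

end WeakEquation

/-! ### The regularised fundamental solution of the bilaplacian -/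

section Bubble

variable {E : Type} [NormedAddCommGroup E] [InnerProductSpace ℝ E]

theorem contDiff_norm_sq_add_rpow {c : ℝ} (hc : 0 < c) (b : ℝ) {n : WithTop ℕ∞} :
    ContDiff ℝ n (fun w : E => (‖w‖ ^ 2 + c) ^ b) :=
  ((contDiff_norm_sq ℝ).add contDiff_const).rpow_const_of_ne fun w =>
    (by positivity : 0 < ‖w‖ ^ 2 + c).ne'

theorem hasFDerivAt_norm_sq_add_rpow {c : ℝ} (hc : 0 < c) (b : ℝ) (w : E) :
    HasFDerivAt (fun w : E => (‖w‖ ^ 2 + c) ^ b)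
      ((b * (‖w‖ ^ 2 + c) ^ (b - 1)) • (2 • innerSL ℝ w)) w :=
  ((hasStrictFDerivAt_norm_sq w).hasFDerivAt.add_const c).rpow_const
    (Or.inl (by positivity : 0 < ‖w‖ ^ 2 + c).ne')

variable [FiniteDimensional ℝ E]

/-- Writing ‖w‖² as (‖w‖² + c) - c keeps the Laplacian in the span of powers of ‖w‖² + c, so it can
be iterated. -/
theorem laplacian_norm_sq_add_rpow {c : ℝ} (hc : 0 < c) (b : ℝ) :
    Laplacian.laplacian (fun w : E => (‖w‖ ^ 2 + c) ^ b) = fun w =>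
      (2 * b * (Module.finrank ℝ E + 2 * b - 2)) * (‖w‖ ^ 2 + c) ^ (b - 1) +
        (-4 * b * (b - 1) * c) * (‖w‖ ^ 2 + c) ^ (b - 2) := by
  ext w
  rw [laplacian_eq_sum_fderiv (contDiff_norm_sq_add_rpow hc b).contDiffAt]
  have h1 (v : E) : (fun y : E => fderiv ℝ (fun w : E => (‖w‖ ^ 2 + c) ^ b) y v) =
      fun y => (2 * b) * ((‖y‖ ^ 2 + c) ^ (b - 1) * inner ℝ y v) := by
    ext y
    rw [(hasFDerivAt_norm_sq_add_rpow hc b y).fderiv]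
    simp
    ring
  have h2 (v : E) : fderiv ℝ (fun y : E => fderiv ℝ (fun w : E => (‖w‖ ^ 2 + c) ^ b) y v) w v =
      (2 * b) * ((‖w‖ ^ 2 + c) ^ (b - 1) * ‖v‖ ^ 2 +
        2 * (b - 1) * (‖w‖ ^ 2 + c) ^ (b - 2) * inner ℝ v w ^ 2) := by
    have h3 := ((hasFDerivAt_norm_sq_add_rpow hc (b - 1) w).mul
      ((hasFDerivAt_id w).inner ℝ (hasFDerivAt_const v w))).const_mul (2 * b)
    rw [h1]
    have h4 := h3.fderiv
    simp only [id] at h4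
    change fderiv ℝ (fun y => 2 * b * ((‖y‖ ^ 2 + c) ^ (b - 1) * inner ℝ y v)) w = _ at h4
    rw [h4]
    simp [real_inner_comm v w, show b - 1 - 1 = b - 2 by ring]
    ring
  simp only [h2]
  rw [← Finset.mul_sum, Finset.sum_add_distrib, ← Finset.mul_sum, ← Finset.mul_sum]
  have h5 : ∑ i, inner ℝ (stdOrthonormalBasis ℝ E i) w ^ 2 = ‖w‖ ^ 2 := by
    have := (stdOrthonormalBasis ℝ E).sum_sq_norm_inner_right w
    simpa using this
  have h6 : ∑ i, ‖stdOrthonormalBasis ℝ E i‖ ^ 2 = Module.finrank ℝ E := by simp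
  have h7 : (‖w‖ ^ 2 + c) ^ (b - 1) = (‖w‖ ^ 2 + c) ^ (b - 2) * (‖w‖ ^ 2 + c) := by
    rw [← Real.rpow_add_one (by positivity : 0 < ‖w‖ ^ 2 + c).ne']
    congr 1; ring
  rw [h5, h6, h7]
  ring

/-- The regularised fundamental solution `(‖w‖ ^ 2 + c) ^ ((4 - n) / 2)` has an explicit
bilaplacian. -/
theorem bilaplacian_norm_sq_add_rpow {c : ℝ} (hc : 0 < c) {b : ℝ}
    (hb : 2 * b = 4 - Module.finrank ℝ E) (w : E) :
    Laplacian.laplacian (Laplacian.laplacian fun w : E => (‖w‖ ^ 2 + c) ^ b) w =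
      16 * (b * (b - 1) * (b - 2) * (b - 3)) * c ^ 2 * (‖w‖ ^ 2 + c) ^ (b - 4) := by
  -- With this dimension the coefficients of the powers b - 2 and b - 3 cancel, and only the power b
  -- - 4 survives.
  have hn : (Module.finrank ℝ E : ℝ) = 4 - 2 * b := by linarith
  have hs (e : ℝ) : ContDiffAt ℝ 2 (fun w : E => (‖w‖ ^ 2 + c) ^ e) w :=
    (contDiff_norm_sq_add_rpow hc e).contDiffAt
  rw [laplacian_norm_sq_add_rpow hc b]
  set α := 2 * b * (Module.finrank ℝ E + 2 * b - 2) with hα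
  set β := -4 * b * (b - 1) * c with hβ
  have h1 := ContDiffAt.laplacian_add (f₁ := fun w : E => α * (‖w‖ ^ 2 + c) ^ (b - 1))
    (f₂ := fun w : E => β * (‖w‖ ^ 2 + c) ^ (b - 2)) (contDiffAt_const.mul (hs _))
    (contDiffAt_const.mul (hs _))
  rw [Pi.add_def] at h1
  rw [h1, laplacian_const_mul _ (hs _), laplacian_const_mul _ (hs _), laplacian_norm_sq_add_rpow hc,
    laplacian_norm_sq_add_rpow hc, hα, hβ, hn, show b - 1 - 1 = b - 2 by ring,
    show b - 1 - 2 = b - 3 by ring, show b - 2 - 1 = b - 3 by ring, show b - 2 - 2 = b - 4 by ring]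
  ring

/-- On the annulus ‖w‖² + t² stays in [1, 5], away from the singularity of s^b, so the bound is
uniform in t. -/
theorem exists_norm_iteratedFDeriv_norm_sq_add_rpow_le (b : ℝ) : ∃ B : ℝ, ∀ t : ℝ, 0 < t → t ≤ 1 →
    ∀ w : E, 1 ≤ ‖w‖ → ‖w‖ ≤ 2 → ∀ i ≤ 4,
      ‖iteratedFDeriv ℝ i (fun w : E => (‖w‖ ^ 2 + t ^ 2) ^ b) w‖ ≤ B := by
  have hg : ContDiffOn ℝ 4 (fun s : ℝ => s ^ b) (Ioi 0) := fun s hs =>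
    (Real.contDiffAt_rpow_const_of_ne (ne_of_gt hs)).contDiffWithinAt
  have hC (i : ℕ) (hi : i ≤ 4) : ∃ C, ∀ s ∈ Icc (1 : ℝ) 5,
      ‖iteratedFDerivWithin ℝ i (fun s : ℝ => s ^ b) (Ioi 0) s‖ ≤ C := by
    refine isCompact_Icc.exists_bound_of_continuousOn ?_
    exact (hg.continuousOn_iteratedFDerivWithin (by exact_mod_cast hi)
      (uniqueDiffOn_Ioi 0)).mono fun s hs => zero_lt_one.trans_le hs.1
  have hD (i : ℕ) : ∃ C, ∀ w ∈ Metric.closedBall (0 : E) 2,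
      ‖iteratedFDeriv ℝ i (fun w : E => ‖w‖ ^ 2) w‖ ≤ C :=
    (isCompact_closedBall _ _).exists_bound_of_continuousOn
      ((contDiff_norm_sq ℝ (n := i)).continuous_iteratedFDeriv le_rfl).continuousOn
  choose! C hC using hC
  choose D hD using hD
  set C' : ℝ := ∑ i ∈ Finset.range 5, |C i|
  set D' : ℝ := 1 + ∑ i ∈ Finset.range 5, |D i|
  have hC' (i : ℕ) (hi : i ≤ 4) : C i ≤ C' := (le_abs_self _).trans
    (Finset.single_le_sum (f := fun i => |C i|) (fun i _ => abs_nonneg _)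
      (Finset.mem_range.2 (by omega : i < 5)))
  have hD' (i : ℕ) (hi : i ≤ 4) : D i ≤ D' := (le_abs_self _).trans
    ((Finset.single_le_sum (f := fun i => |D i|) (fun i _ => abs_nonneg _)
      (Finset.mem_range.2 (by omega : i < 5))).trans (by simp [D']))
  have hD1 : 1 ≤ D' := le_add_of_nonneg_right (Finset.sum_nonneg fun i _ => abs_nonneg _)
  have hC0 : 0 ≤ C' := Finset.sum_nonneg fun i _ => abs_nonneg _
  refine ⟨24 * C' * D' ^ 4, fun t ht0 ht1 w hw1 hw2 i hi => ?_⟩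
  have hf : ContDiff ℝ 4 (fun w : E => ‖w‖ ^ 2 + t ^ 2) := (contDiff_norm_sq ℝ).add contDiff_const
  have h := norm_iteratedFDeriv_comp_le' (𝕜 := ℝ) (g := fun s : ℝ => s ^ b)
    (f := fun w : E => ‖w‖ ^ 2 + t ^ 2) (t := Ioi 0) (n := i) (N := 4)
    (range_subset_iff.2 fun w => (by positivity : 0 < ‖w‖ ^ 2 + t ^ 2)) (uniqueDiffOn_Ioi 0) hg hf
    (by exact_mod_cast hi) w (C := C') (D := D')
    (fun j hj => (hC j (by omega) _ ⟨by nlinarith, by nlinarith⟩).trans (hC' j (by omega)))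
    (fun j hj1 hj => by
      have e1 : iteratedFDeriv ℝ j (fun w : E => ‖w‖ ^ 2 + t ^ 2) w =
          iteratedFDeriv ℝ j (fun w : E => ‖w‖ ^ 2) w := by
        have : (fun w : E => ‖w‖ ^ 2 + t ^ 2) = (fun w : E => ‖w‖ ^ 2) + fun _ => t ^ 2 := rfl
        rw [this, iteratedFDeriv_add_apply (contDiff_norm_sq ℝ).contDiffAt contDiff_const.contDiffAt,
          iteratedFDeriv_const_of_ne (by omega), Pi.zero_apply, add_zero]
      rw [e1]
      exact ((hD j w (mem_closedBall_zero_iff.2 hw2)).trans (hD' j (by omega))).trans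
        (le_self_pow₀ hD1 (by omega)))
  refine h.trans ?_
  have hfac : (i.factorial : ℝ) ≤ 24 := by
    exact_mod_cast (Nat.factorial_le hi).trans_eq (by decide)
  have hpow : D' ^ i ≤ D' ^ 4 := pow_le_pow_right₀ hD1 hi
  gcongr

/-- The case R = 1. Where the cutoff is locally 1 or 0 the difference vanishes; on the annulus 1 ≤
‖w‖ ≤ 2 both terms are bounded uniformly in t. -/
theorem exists_abs_bilaplacian_unitCutoff_le {b : ℝ} (hb : 2 * b = 4 - Module.finrank ℝ E) :
    ∃ C : ℝ, 0 ≤ C ∧ ∀ t : ℝ, 0 < t → t ≤ 1 → ∀ w : E,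
    |Laplacian.laplacian (Laplacian.laplacian
        fun w : E => (‖w‖ ^ 2 + t ^ 2) ^ b * unitCutoff E w) w -
      16 * (b * (b - 1) * (b - 2) * (b - 3)) * t ^ 4 * (‖w‖ ^ 2 + t ^ 2) ^ (b - 4) *
        unitCutoff E w| ≤ (Metric.closedBall 0 2).indicator (fun _ => C) w := by
  obtain ⟨B₁, hB₁⟩ := exists_norm_iteratedFDeriv_norm_sq_add_rpow_le (E := E) b
  obtain ⟨B₂, hB₂1, hB₂⟩ := exists_norm_iteratedFDeriv_le (unitCutoff E).contDiff
    (unitCutoff E).hasCompactSupport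
  set k : ℝ := 16 * (b * (b - 1) * (b - 2) * (b - 3))
  set C : ℝ := |bilaplacianBound E * (16 * B₁ * B₂ ^ 4)| + |k|
  have hC0 : 0 ≤ C := by positivity
  refine ⟨C, hC0, fun t ht0 ht1 w => ?_⟩
  have ht2 : 0 < t ^ 2 := by positivity
  rcases lt_or_ge ‖w‖ 1 with hw1 | hw1
  · have he : (unitCutoff E : E → ℝ) =ᶠ[𝓝 w] 1 :=
      (unitCutoff E).eventuallyEq_one_of_mem_ball (mem_ball_zero_iff.2 hw1)
    have he2 : (fun w : E => (‖w‖ ^ 2 + t ^ 2) ^ b * unitCutoff E w) =ᶠ[𝓝 w]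
        fun w : E => (‖w‖ ^ 2 + t ^ 2) ^ b := by
      filter_upwards [he] with y hy
      rw [hy, Pi.one_apply, mul_one]
    rw [bilaplacian_congr he2, bilaplacian_norm_sq_add_rpow ht2 hb, he.self_of_nhds, Pi.one_apply,
      mul_one, ← pow_mul, sub_self, abs_zero]
    exact indicator_nonneg (fun _ _ => hC0) w
  rcases lt_or_ge 2 ‖w‖ with hw2 | hw2
  · have he2 : (fun w : E => (‖w‖ ^ 2 + t ^ 2) ^ b * unitCutoff E w) =ᶠ[𝓝 w] fun _ => 0 := by
      filter_upwards [(isOpen_lt continuous_const continuous_norm).mem_nhds hw2] with y hy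
      rw [(unitCutoff E).zero_of_le_dist (by rw [dist_zero_right]; exact le_of_lt hy), mul_zero]
    have e0 : unitCutoff E w = 0 :=
      (unitCutoff E).zero_of_le_dist (by rw [dist_zero_right]; exact hw2.le)
    rw [bilaplacian_congr he2, e0, mul_zero, InnerProductSpace.laplacian_const]
    have : Laplacian.laplacian (0 : E → ℝ) w = 0 :=
      congrFun (InnerProductSpace.laplacian_const (c := (0 : ℝ))) w
    rw [this, sub_zero, abs_zero]
    exact indicator_nonneg (fun _ _ => hC0) w
  · rw [indicator_of_mem (mem_closedBall_zero_iff.2 hw2)]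
    refine (abs_sub _ _).trans (add_le_add ?_ ?_)
    · refine (abs_bilaplacian_mul_le (contDiff_norm_sq_add_rpow ht2 b) (unitCutoff E).contDiff hB₂1
        (fun i hi => hB₁ t ht0 ht1 w hw1 hw2 i hi) ?h
        (fun i h1 h4 => (hB₂ i h4 w).trans (le_self_pow₀ hB₂1 (by omega)))).trans (le_abs_self _)
      rw [Real.norm_of_nonneg (unitCutoff E).nonneg]
      exact (unitCutoff E).le_one
    · have h1 : (‖w‖ ^ 2 + t ^ 2) ^ (b - 4) ≤ 1 :=
        Real.rpow_le_one_of_one_le_of_nonpos (by nlinarith)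
          (by linarith [(Nat.cast_nonneg _ : (0 : ℝ) ≤ Module.finrank ℝ E)])
      have h2 : 0 ≤ (‖w‖ ^ 2 + t ^ 2) ^ (b - 4) := by positivity
      rw [abs_mul, abs_mul, abs_mul, abs_of_nonneg h2, abs_of_nonneg (unitCutoff E).nonneg,
        abs_of_nonneg (by positivity : 0 ≤ t ^ 4)]
      have h3 : t ^ 4 ≤ 1 := pow_le_one₀ ht0.le ht1
      calc |k| * t ^ 4 * (‖w‖ ^ 2 + t ^ 2) ^ (b - 4) * unitCutoff E w ≤ |k| * 1 * 1 * 1 := by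
            gcongr
            · exact (unitCutoff E).nonneg
            · exact (unitCutoff E).le_one
        _ = |k| := by ring

/-- The truncated, regularised fundamental solution is, up to a uniformly small error, a
fundamental solution of the bilaplacian. -/
theorem exists_abs_bilaplacian_ballCutoff_le {b : ℝ} (hb : 2 * b = 4 - Module.finrank ℝ E) :
    ∃ C : ℝ, 0 ≤ C ∧ ∀ δ R : ℝ, 0 < δ → δ ≤ R → ∀ x y : E,
    |Laplacian.laplacian (Laplacian.laplacian
        fun y : E => (‖y - x‖ ^ 2 + δ ^ 2) ^ b * ballCutoff R x y) y -
      (δ⁻¹) ^ Module.finrank ℝ E * (16 * (b * (b - 1) * (b - 2) * (b - 3)) *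
        (1 + ‖δ⁻¹ • (x - y)‖ ^ 2) ^ (b - 4)) * ballCutoff R x y| ≤
    (Metric.closedBall x (2 * R)).indicator (fun _ => C * (R ^ Module.finrank ℝ E)⁻¹) y := by
  obtain ⟨C, hC0, hC⟩ := exists_abs_bilaplacian_unitCutoff_le (E := E) hb
  refine ⟨C, hC0, fun δ R hδ hδR x y => ?_⟩
  have hR : 0 < R := hδ.trans_le hδR
  set n := Module.finrank ℝ E
  set t := δ / R
  have ht : 0 < t := by positivity
  set w := R⁻¹ • (y - x)
  have hw := hC t ht ((div_le_one hR).2 hδR) w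
  set k : ℝ := 16 * (b * (b - 1) * (b - 2) * (b - 3))
  set F : E → ℝ := fun w => (‖w‖ ^ 2 + t ^ 2) ^ b * unitCutoff E w
  have hF : ContDiff ℝ 4 F := (contDiff_norm_sq_add_rpow (by positivity) b).mul (unitCutoff E).contDiff
  have hs (y : E) : ‖R⁻¹ • (y - x)‖ ^ 2 + t ^ 2 = (R⁻¹) ^ 2 * (‖y - x‖ ^ 2 + δ ^ 2) := by
    rw [norm_smul, Real.norm_of_nonneg (by positivity)]; simp only [t]; field_simp
  have hfun : (fun y : E => (‖y - x‖ ^ 2 + δ ^ 2) ^ b * ballCutoff R x y) =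
      fun y => R ^ (2 * b) * F (R⁻¹ • (y - x)) := by
    ext y
    simp only [F, hs, ballCutoff]
    rw [Real.mul_rpow (by positivity) (by positivity), ← Real.rpow_natCast R⁻¹ 2,
      ← Real.rpow_mul (by positivity), Real.inv_rpow hR.le]
    have : R ^ (((2 : ℕ) : ℝ) * b) ≠ 0 := (Real.rpow_pos_of_pos hR _).ne'
    push_cast at this ⊢
    field_simp
  -- Scaling: the kernel is homogeneous of degree 2b = 4 - n under joint scaling of y - x and δ, and
  -- the bilaplacian lowers the degree by 4.
  have hRn : R ^ (2 * b) * ((R⁻¹) ^ 2 * (R⁻¹) ^ 2) = (R ^ n)⁻¹ := by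
    rw [hb, Real.rpow_sub hR, Real.rpow_natCast]
    norm_cast
    field_simp
  have hΔ : Laplacian.laplacian (Laplacian.laplacian
      fun y : E => (‖y - x‖ ^ 2 + δ ^ 2) ^ b * ballCutoff R x y) y =
      (R ^ n)⁻¹ * Laplacian.laplacian (Laplacian.laplacian F) w := by
    have hcomp : ContDiff ℝ 4 fun y => F (R⁻¹ • (y - x)) :=
      hF.comp ((contDiff_id.sub contDiff_const).const_smul _)
    have h1 : (Laplacian.laplacian fun y : E => R ^ (2 * b) * F (R⁻¹ • (y - x))) =
        fun y => R ^ (2 * b) * ((R⁻¹) ^ 2 * Laplacian.laplacian F (R⁻¹ • (y - x))) := by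
      ext y
      rw [laplacian_const_mul _ (hcomp.contDiffAt.of_le (by norm_num)), laplacian_comp_smul_sub]
    have h2 : ContDiff ℝ 2 fun y => Laplacian.laplacian F (R⁻¹ • (y - x)) :=
      (contDiff_iff_contDiffAt.2 fun z => hF.contDiffAt.laplacian (by norm_num)).comp
        ((contDiff_id.sub contDiff_const).const_smul _)
    rw [hfun, h1, laplacian_const_mul _ (contDiff_const.mul h2).contDiffAt,
      laplacian_const_mul _ h2.contDiffAt, laplacian_comp_smul_sub, ← hRn]
    ring
  have hker : (δ⁻¹) ^ n * (k * (1 + ‖δ⁻¹ • (x - y)‖ ^ 2) ^ (b - 4)) =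
      (R ^ n)⁻¹ * (k * t ^ 4 * (‖w‖ ^ 2 + t ^ 2) ^ (b - 4)) := by
    have e1 : ‖w‖ ^ 2 + t ^ 2 = t ^ 2 * (1 + ‖δ⁻¹ • (x - y)‖ ^ 2) := by
      rw [hs, norm_smul, Real.norm_of_nonneg (by positivity), norm_sub_rev x y]
      simp only [t]; field_simp; ring
    have e2 : (t ^ 2) ^ (b - 4) = (t ^ n)⁻¹ * (t ^ 4)⁻¹ := by
      rw [← Real.rpow_natCast, ← Real.rpow_mul ht.le, ← mul_inv, ← pow_add, ← Real.rpow_natCast,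
        ← Real.rpow_neg ht.le]
      congr 1
      push_cast
      linarith
    rw [e1, Real.mul_rpow (by positivity) (by positivity), e2]
    simp only [t, div_pow, inv_pow]
    field_simp
  rw [hΔ, hker, show ballCutoff R x y = unitCutoff E w from rfl]
  have e3 : (R ^ n)⁻¹ * Laplacian.laplacian (Laplacian.laplacian F) w -
      (R ^ n)⁻¹ * (k * t ^ 4 * (‖w‖ ^ 2 + t ^ 2) ^ (b - 4)) * unitCutoff E w =
      (R ^ n)⁻¹ * (Laplacian.laplacian (Laplacian.laplacian F) w -
        k * t ^ 4 * (‖w‖ ^ 2 + t ^ 2) ^ (b - 4) * unitCutoff E w) := by ring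
  rw [e3, abs_mul, abs_of_pos (by positivity)]
  refine (mul_le_mul_of_nonneg_left hw (by positivity)).trans_eq ?_
  have hmem : w ∈ Metric.closedBall (0 : E) 2 ↔ y ∈ Metric.closedBall x (2 * R) := by
    rw [mem_closedBall_zero_iff, norm_inv_smul_sub hR, Metric.mem_closedBall, div_le_iff₀ hR]
  by_cases hy : y ∈ Metric.closedBall x (2 * R)
  · rw [indicator_of_mem hy, indicator_of_mem (hmem.2 hy), mul_comm]
  · rw [indicator_of_notMem hy, indicator_of_notMem (fun h => hy (hmem.1 h)), mul_zero]

end Bubble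

/-! ### The mass of the bubble and its concentration -/

section Potential

variable {E : Type} [NormedAddCommGroup E] [InnerProductSpace ℝ E] [FiniteDimensional ℝ E]
  [MeasurableSpace E] [BorelSpace E]

theorem integrable_one_add_norm_sq_rpow_neg {a : ℝ} (ha : (Module.finrank ℝ E : ℝ) / 2 < a) :
    Integrable (fun w : E => (1 + ‖w‖ ^ 2) ^ (-a)) := by
  have := integrable_rpow_neg_one_add_norm_sq (E := E) (μ := volume) (r := 2 * a) (by linarith)
  refine this.congr (Eventually.of_forall fun w => ?_)
  simp only
  congr 1
  ring

/-- Write Γ(a)(1 + ‖w‖²)^(-a) as ∫ t^(a-1) e^(-(1+‖w‖²)t) dt and exchange the integrals: the inner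
one becomes Gaussian, the outer one a Gamma integral. -/
theorem integral_one_add_norm_sq_rpow_neg {a : ℝ} (ha : (Module.finrank ℝ E : ℝ) / 2 < a) :
    ∫ w : E, (1 + ‖w‖ ^ 2) ^ (-a) =
      Real.pi ^ ((Module.finrank ℝ E : ℝ) / 2) * Real.Gamma (a - (Module.finrank ℝ E : ℝ) / 2) /
        Real.Gamma a := by
  set n := Module.finrank ℝ E
  have ha0 : 0 < a := lt_of_le_of_lt (by positivity) ha
  set f : E → ℝ → ℝ := fun w t => t ^ (a - 1) * Real.exp (-((1 + ‖w‖ ^ 2) * t)) with hf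
  have hin (w : E) : ∫ t in Ioi (0 : ℝ), f w t = (1 + ‖w‖ ^ 2) ^ (-a) * Real.Gamma a := by
    rw [Real.integral_rpow_mul_exp_neg_mul_Ioi ha0 (by positivity : 0 < 1 + ‖w‖ ^ 2), one_div,
      Real.inv_rpow (by positivity), Real.rpow_neg (by positivity)]
  have hf0 (w : E) (t : ℝ) (ht : t ∈ Ioi (0 : ℝ)) : 0 ≤ f w t :=
    mul_nonneg (Real.rpow_nonneg (le_of_lt ht) _) (Real.exp_nonneg _)
  -- A non-integrable function would have integral 0 by convention, but the value in `hin` is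
  -- positive.
  have hfi (w : E) : IntegrableOn (f w) (Ioi 0) := by
    by_contra h
    have h1 := hin w
    rw [integral_undef h] at h1
    exact (mul_pos (Real.rpow_pos_of_pos (by positivity) _) (Real.Gamma_pos_of_pos ha0)).ne h1
  have hmeas : Measurable (Function.uncurry f) := by
    have h1 : Measurable fun z : E × ℝ => z.2 ^ (a - 1) := measurable_snd.pow_const _
    have h2 : Continuous fun z : E × ℝ => Real.exp (-((1 + ‖z.1‖ ^ 2) * z.2)) := by fun_prop
    exact h1.mul h2.measurable
  have hint : Integrable (Function.uncurry f) (volume.prod (volume.restrict (Ioi 0))) := by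
    rw [integrable_prod_iff hmeas.aestronglyMeasurable]
    refine ⟨Eventually.of_forall hfi, ?_⟩
    refine ((integrable_one_add_norm_sq_rpow_neg ha).mul_const (Real.Gamma a)).congr
      (Eventually.of_forall fun w => ?_)
    beta_reduce
    rw [← hin w]
    refine setIntegral_congr_fun measurableSet_Ioi fun t ht => ?_
    exact (Real.norm_of_nonneg (hf0 w t ht)).symm
  have hswap := integral_integral_swap hint
  simp only [hin] at hswap
  rw [integral_mul_const] at hswap
  have hout : ∫ t in Ioi (0 : ℝ), ∫ w : E, f w t =
      Real.pi ^ ((n : ℝ) / 2) * Real.Gamma (a - (n : ℝ) / 2) := by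
    have h1 : ∫ t in Ioi (0 : ℝ), ∫ w : E, f w t = ∫ t in Ioi (0 : ℝ),
        Real.pi ^ ((n : ℝ) / 2) * (t ^ (a - (n : ℝ) / 2 - 1) * Real.exp (-(1 * t))) := by
      refine setIntegral_congr_fun measurableSet_Ioi fun t ht => ?_
      have ht0 : 0 < t := ht
      have h2 (w : E) : f w t = (t ^ (a - 1) * Real.exp (-(1 * t))) * Real.exp (-t * ‖w‖ ^ 2) := by
        change t ^ (a - 1) * Real.exp (-((1 + ‖w‖ ^ 2) * t)) = _
        rw [mul_assoc, ← Real.exp_add]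
        congr 2
        ring
      simp only [h2]
      rw [integral_const_mul, GaussianFourier.integral_rexp_neg_mul_sq_norm ht0,
        Real.div_rpow Real.pi_pos.le ht0.le,
        show a - (n : ℝ) / 2 - 1 = (a - 1) - (n : ℝ) / 2 by ring, Real.rpow_sub ht0 (a - 1)]
      ring
    rw [h1, integral_const_mul, Real.integral_rpow_mul_exp_neg_mul_Ioi (by linarith) one_pos]
    simp
  rw [hout] at hswap
  rw [eq_div_iff (Real.Gamma_pos_of_pos ha0).ne', hswap]

/-- Divided by its mass, the bubble is an approximate identity; 2a > n gives the decay required at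
infinity. -/
theorem tendsto_integral_bubble {a : ℝ} (ha : (Module.finrank ℝ E : ℝ) / 2 < a) (k : ℝ)
    {g : E → ℝ} (hg : Integrable g) {x : E} (hgx : ContinuousAt g x) :
    Tendsto (fun c : ℝ => ∫ y, c ^ Module.finrank ℝ E *
      (k * (1 + ‖c • (x - y)‖ ^ 2) ^ (-a)) * g y) atTop
      (𝓝 (k * (∫ w : E, (1 + ‖w‖ ^ 2) ^ (-a)) * g x)) := by
  set I := ∫ w : E, (1 + ‖w‖ ^ 2) ^ (-a) with hI
  set n := Module.finrank ℝ E
  have hn0 : (0 : ℝ) ≤ (n : ℝ) / 2 := by positivity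
  have hIpos : 0 < I := by
    rw [hI, integral_one_add_norm_sq_rpow_neg ha]
    have := Real.pi_pos
    have h1 := Real.Gamma_pos_of_pos (by linarith : 0 < a)
    have h2 := Real.Gamma_pos_of_pos (by linarith : 0 < a - (n : ℝ) / 2)
    positivity
  have h := tendsto_integral_comp_smul_smul_of_integrable' (μ := (volume : Measure E))
    (φ := fun w : E => I⁻¹ * (1 + ‖w‖ ^ 2) ^ (-a)) (fun w => by positivity)
    (by rw [integral_const_mul, inv_mul_cancel₀ hIpos.ne']) ?_ hg hgx
  · have h2 := h.const_mul (k * I)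
    refine h2.congr fun c => ?_
    rw [← integral_const_mul]
    refine integral_congr_ae (Eventually.of_forall fun y => ?_)
    simp only [smul_eq_mul]
    field_simp
    ring
  · have h1 : Tendsto (fun w : E => I⁻¹ * ‖w‖ ^ (-(2 * a - n))) (Bornology.cobounded E) (𝓝 0) := by
      have := ((tendsto_rpow_neg_atTop (y := 2 * a - n) (by linarith)).comp
        (tendsto_norm_cobounded_atTop (E := E))).const_mul I⁻¹
      rwa [mul_zero] at this
    refine squeeze_zero' (Eventually.of_forall fun w => by positivity) ?_ h1
    filter_upwards [tendsto_norm_cobounded_atTop.eventually_gt_atTop 0] with w hw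
    have h2 : (1 + ‖w‖ ^ 2) ^ (-a) ≤ (‖w‖ ^ 2) ^ (-a) :=
      Real.rpow_le_rpow_of_nonpos (by positivity) (by linarith) (by linarith)
    have h3 : ‖w‖ ^ n * (‖w‖ ^ 2) ^ (-a) = ‖w‖ ^ (-(2 * a - n)) := by
      rw [← Real.rpow_natCast, ← Real.rpow_natCast, ← Real.rpow_mul hw.le, ← Real.rpow_add hw]
      congr 1
      push_cast
      ring
    calc ‖w‖ ^ n * (I⁻¹ * (1 + ‖w‖ ^ 2) ^ (-a)) ≤ ‖w‖ ^ n * (I⁻¹ * (‖w‖ ^ 2) ^ (-a)) := by gcongr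
      _ = I⁻¹ * ‖w‖ ^ (-(2 * a - n)) := by rw [← h3]; ring

end Potential

/-! ### The representation formula -/

section Representation

variable {E : Type} [NormedAddCommGroup E] [InnerProductSpace ℝ E] [FiniteDimensional ℝ E]
  [MeasurableSpace E] [BorelSpace E]

variable {p q : ℝ} {Z : Set E} {u : E → ℝ}

/-- The limit δ → 0 at fixed R. The error of the truncated kernel is integrated against u, and C
does not depend on R, so the right-hand side is controlled by
`IsNonnegPuncturedSolution.tendsto_average`. -/
theorem IsNonnegPuncturedSolution.integrable_riesz_mul_ballCutoff
    (hu : IsNonnegPuncturedSolution p Z u)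
    (hpq : p.HolderConjugate q) (hZ : IsCompact Z) (hthin : HasThinNeighborhoods (4 * q) Z)
    {b : ℝ} (hb : 2 * b = 4 - Module.finrank ℝ E) (hb0 : b < 0) {x : E} (hx : x ∉ Z) :
    ∃ C : ℝ, ∀ R : ℝ, 0 < R →
      Integrable (fun y => u y ^ p * (‖y - x‖ ^ 2) ^ b * ballCutoff R x y) ∧
      |(∫ y, u y ^ p * (‖y - x‖ ^ 2) ^ b * ballCutoff R x y) -
        16 * (b * (b - 1) * (b - 2) * (b - 3)) * (∫ w : E, (1 + ‖w‖ ^ 2) ^ (-(4 - b))) * u x| ≤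
      C * ((R ^ Module.finrank ℝ E)⁻¹ * ∫ y in Metric.closedBall x (2 * R), u y) := by
  obtain ⟨C, hC0, hC⟩ := exists_abs_bilaplacian_ballCutoff_le (E := E) hb
  refine ⟨C, fun R hR => ?_⟩
  have hfr : 0 < Module.finrank ℝ E := by
    have : (0 : ℝ) < Module.finrank ℝ E := by linarith
    exact_mod_cast this
  have : Nontrivial E := Module.nontrivial_of_finrank_pos hfr
  set n := Module.finrank ℝ E
  set k : ℝ := 16 * (b * (b - 1) * (b - 2) * (b - 3))
  set I : ℝ := ∫ w : E, (1 + ‖w‖ ^ 2) ^ (-(4 - b))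
  set S := Metric.closedBall x (2 * R)
  have hSm : MeasurableSet S := Metric.isClosed_closedBall.measurableSet
  set e : ℝ := C * ((R ^ n)⁻¹ * ∫ y in S, u y)
  have huS : IntegrableOn u S := hu.integrableOn hpq hZ hthin x _
  set δ : ℕ → ℝ := fun j => R / ((j : ℝ) + 1)
  have hδ (j : ℕ) : 0 < δ j := by positivity
  have hδR (j : ℕ) : δ j ≤ R :=
    div_le_self hR.le (by linarith [(Nat.cast_nonneg j : (0 : ℝ) ≤ j)])
  have hδ0 : Tendsto δ atTop (𝓝 0) :=
    tendsto_const_nhds.div_atTop (tendsto_atTop_add_const_right _ _ tendsto_natCast_atTop_atTop)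
  have hδinv : Tendsto (fun j => (δ j)⁻¹) atTop atTop := by
    refine Tendsto.inv_tendsto_nhdsGT_zero (tendsto_nhdsWithin_iff.2 ⟨hδ0, ?_⟩)
    exact Eventually.of_forall hδ
  set ψ : ℕ → E → ℝ := fun j y => (‖y - x‖ ^ 2 + δ j ^ 2) ^ b * ballCutoff R x y
  have hψs (j : ℕ) : ContDiff ℝ ∞ (ψ j) :=
    ((contDiff_norm_sq_add_rpow (by have := hδ j; positivity) b).comp
      (contDiff_id.sub contDiff_const)).mul (contDiff_ballCutoff R x)
  have hweak (j : ℕ) := hu.integral_rpow_mul_eq hpq hZ hthin (hψs j)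
    (hasCompactSupport_ballCutoff hR x).mul_left
  set g : E → ℝ := fun y => u y * ballCutoff R x y
  have hg : Integrable g := integrable_mul_of_integrableOn_closedBall
    (hu.integrableOn hpq hZ hthin 0) (contDiff_ballCutoff R x).continuous
    (hasCompactSupport_ballCutoff hR x)
  have hgx : ContinuousAt g x :=
    (hu.contDiffOn.continuousOn.continuousAt (hZ.isClosed.isOpen_compl.mem_nhds hx)).mul
      (contDiff_ballCutoff R x).continuous.continuousAt
  have hgx1 : g x = u x := by
    simp only [g]; rw [ballCutoff_eq_one hR (by simpa using hR.le), mul_one]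
  -- Here 4 - b = n/2 + 2.
  have hbub := tendsto_integral_bubble (a := 4 - b) (by linarith) k hg hgx
  rw [hgx1] at hbub
  set J : ℕ → ℝ := fun j => ∫ y, (δ j)⁻¹ ^ n * (k * (1 + ‖(δ j)⁻¹ • (x - y)‖ ^ 2) ^ (-(4 - b))) * g y
  have hJ : Tendsto J atTop (𝓝 (k * I * u x)) := hbub.comp hδinv
  have hclose (j : ℕ) : |(∫ y, u y ^ p * ψ j y) - J j| ≤ e := by
    have hKb (y : E) : (1 + ‖(δ j)⁻¹ • (x - y)‖ ^ 2) ^ (-(4 - b)) ≤ 1 :=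
      Real.rpow_le_one_of_one_le_of_nonpos (by nlinarith [norm_nonneg ((δ j)⁻¹ • (x - y))])
        (by linarith)
    have hJi : Integrable fun y => (δ j)⁻¹ ^ n *
        (k * (1 + ‖(δ j)⁻¹ • (x - y)‖ ^ 2) ^ (-(4 - b))) * g y := by
      refine hg.bdd_mul (c := |(δ j)⁻¹ ^ n * k|) ?_ (Eventually.of_forall fun y => ?_)
      · have : Continuous fun y => (1 + ‖(δ j)⁻¹ • (x - y)‖ ^ 2) ^ (-(4 - b)) :=
          Continuous.rpow_const (by fun_prop) fun y => Or.inl (by positivity)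
        exact (continuous_const.mul (continuous_const.mul this)).aestronglyMeasurable
      · rw [← mul_assoc, Real.norm_eq_abs, abs_mul, abs_of_nonneg (a := _ ^ (-(4 - b))) (by positivity)]
        exact mul_le_of_le_one_right (abs_nonneg _) (hKb y)
    rw [(hweak j).2.2, ← integral_sub (hweak j).2.1 hJi, ← Real.norm_eq_abs]
    have h1 := norm_integral_le_of_norm_le
      (f := fun y => u y * Laplacian.laplacian (Laplacian.laplacian (ψ j)) y - (δ j)⁻¹ ^ n *
        (k * (1 + ‖(δ j)⁻¹ • (x - y)‖ ^ 2) ^ (-(4 - b))) * g y)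
      ((integrable_indicator_iff hSm).2 (huS.const_mul (C * (R ^ n)⁻¹)))
      (Eventually.of_forall fun y => by
        have h2 := hC (δ j) R (hδ j) (hδR j) x y
        rw [show b - 4 = -(4 - b) by ring] at h2
        have h3 : u y * Laplacian.laplacian (Laplacian.laplacian (ψ j)) y - (δ j)⁻¹ ^ n *
            (k * (1 + ‖(δ j)⁻¹ • (x - y)‖ ^ 2) ^ (-(4 - b))) * g y =
            u y * (Laplacian.laplacian (Laplacian.laplacian (ψ j)) y - (δ j)⁻¹ ^ n *
            (k * (1 + ‖(δ j)⁻¹ • (x - y)‖ ^ 2) ^ (-(4 - b))) * ballCutoff R x y) := by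
          simp only [g]; ring
        rw [h3, norm_mul, Real.norm_of_nonneg (hu.nonneg y), Real.norm_eq_abs]
        refine (mul_le_mul_of_nonneg_left h2 (hu.nonneg y)).trans_eq ?_
        by_cases hy : y ∈ Metric.closedBall x (2 * R)
        · rw [indicator_of_mem hy, indicator_of_mem hy, mul_comm]
        · rw [indicator_of_notMem hy, indicator_of_notMem hy, mul_zero])
    refine h1.trans_eq ?_
    rw [integral_indicator hSm, integral_const_mul]
    ring
  -- The point y = x must be excluded: there the right-hand side is `0 ^ b = 0` by convention. It is
  -- a null set.
  have hΓle (j : ℕ) (y : E) (hy : y ≠ x) : (‖y - x‖ ^ 2 + δ j ^ 2) ^ b ≤ (‖y - x‖ ^ 2) ^ b := by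
    have : 0 < ‖y - x‖ := norm_pos_iff.2 (sub_ne_zero.2 hy)
    exact Real.rpow_le_rpow_of_nonpos (by positivity) (by nlinarith [hδ j]) hb0.le
  have hae : ∀ᵐ y : E, y ≠ x := measure_eq_zero_iff_ae_notMem.1 (measure_singleton x)
  obtain ⟨B, hB⟩ := hJ.bddAbove_range
  obtain ⟨hint, hlim⟩ := integrable_and_tendsto_of_le_of_integral_le (μ := (volume : Measure E))
    (F := fun j y => u y ^ p * ψ j y)
    (f := fun y => u y ^ p * (‖y - x‖ ^ 2) ^ b * ballCutoff R x y) (fun j => (hweak j).1)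
    (fun j => Eventually.of_forall fun y => mul_nonneg (Real.rpow_nonneg (hu.nonneg y) p)
      (mul_nonneg (by positivity) (ballCutoff_nonneg _ _ _)))
    (fun j => by
      filter_upwards [hae] with y hy
      have h1 := hΓle j y hy
      have h2 := Real.rpow_nonneg (hu.nonneg y) p
      have h3 := ballCutoff_nonneg R x y
      simp only [ψ]
      rw [mul_assoc]
      gcongr)
    (by
      filter_upwards [hae] with y hy
      have h1 : 0 < ‖y - x‖ := norm_pos_iff.2 (sub_ne_zero.2 hy)
      have h2 : Tendsto (fun j => ‖y - x‖ ^ 2 + δ j ^ 2) atTop (𝓝 (‖y - x‖ ^ 2)) := by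
        simpa using (hδ0.pow 2).const_add (‖y - x‖ ^ 2)
      simp only [ψ, mul_assoc]
      exact ((h2.rpow_const (Or.inl (by positivity))).mul_const _).const_mul _)
    (B := B + e)
    (fun j => by
      have h1 := (abs_le.1 (hclose j)).2
      have h2 : J j ≤ B := hB ⟨j, rfl⟩
      linarith)
  exact ⟨hint, le_of_tendsto ((hlim.sub hJ).abs) (Eventually.of_forall hclose)⟩

theorem IsNonnegPuncturedSolution.integrable_riesz (hu : IsNonnegPuncturedSolution p Z u)
    (hpq : p.HolderConjugate q) (hZ : IsCompact Z) (hthin : HasThinNeighborhoods (4 * q) Z)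
    {b : ℝ} (hb : 2 * b = 4 - Module.finrank ℝ E) (hb0 : b < 0) {x : E} (hx : x ∉ Z) :
    Integrable (fun y => u y ^ p * (‖y - x‖ ^ 2) ^ b) ∧
    ∫ y, u y ^ p * (‖y - x‖ ^ 2) ^ b =
      16 * (b * (b - 1) * (b - 2) * (b - 3)) * (∫ w : E, (1 + ‖w‖ ^ 2) ^ (-(4 - b))) * u x := by
  obtain ⟨C, hC⟩ := hu.integrable_riesz_mul_ballCutoff hpq hZ hthin hb hb0 hx
  set L : ℝ := 16 * (b * (b - 1) * (b - 2) * (b - 3)) *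
    (∫ w : E, (1 + ‖w‖ ^ 2) ^ (-(4 - b))) * u x
  set R : ℕ → ℝ := fun j => (j : ℝ) + 1
  have hR (j : ℕ) : 0 < R j := by positivity
  have hRlim : Tendsto R atTop atTop :=
    tendsto_atTop_add_const_right _ _ tendsto_natCast_atTop_atTop
  have herr := ((hu.tendsto_average hpq hZ hthin x).comp hRlim).const_mul C
  rw [mul_zero] at herr
  have hlimL : Tendsto (fun j => ∫ y, u y ^ p * (‖y - x‖ ^ 2) ^ b * ballCutoff (R j) x y) atTop
      (𝓝 L) := by
    rw [tendsto_iff_norm_sub_tendsto_zero]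
    exact squeeze_zero (fun _ => norm_nonneg _) (fun j => (hC (R j) (hR j)).2) herr
  obtain ⟨B, hB⟩ := hlimL.bddAbove_range
  have h0 (y : E) : 0 ≤ u y ^ p * (‖y - x‖ ^ 2) ^ b :=
    mul_nonneg (Real.rpow_nonneg (hu.nonneg y) p) (by positivity)
  obtain ⟨hint, hlim⟩ := integrable_and_tendsto_of_le_of_integral_le
    (f := fun y => u y ^ p * (‖y - x‖ ^ 2) ^ b) (fun j => (hC (R j) (hR j)).1)
    (fun j => Eventually.of_forall fun y => mul_nonneg (h0 y) (ballCutoff_nonneg _ _ _))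
    (fun j => Eventually.of_forall fun y =>
      mul_le_of_le_one_right (h0 y) (ballCutoff_le_one _ _ _))
    (Eventually.of_forall fun y => by
      refine tendsto_const_nhds.congr' ?_
      filter_upwards [hRlim.eventually_ge_atTop (dist y x)] with j hj
      rw [ballCutoff_eq_one (hR j) hj, mul_one])
    (fun j => hB ⟨j, rfl⟩)
  exact ⟨hint, tendsto_nhds_unique hlim hlimL⟩

end Representation

/-! ### Both hypotheses on Z give thin neighbourhoods -/

section ThinNeighborhoods

section General

variable {E : Type} [NormedAddCommGroup E] [InnerProductSpace ℝ E] [FiniteDimensional ℝ E]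
  [MeasurableSpace E] [BorelSpace E]

/-- The bound is known for Hausdorff measure, of which the volume is a multiple by uniqueness of
Haar measure. -/
theorem LipschitzOnWith.volume_image_le {K : NNReal} {f : E → E} {s : Set E}
    (hf : LipschitzOnWith K f s) : volume (f '' s) ≤ (K : ℝ≥0∞) ^ Module.finrank ℝ E * volume s := by
  have h := hf.hausdorffMeasure_image_le (d := Module.finrank ℝ E) (by positivity)
  rw [Measure.isAddLeftInvariant_eq_smul (volume : Measure E) (μH[Module.finrank ℝ E])]
  rw [ENNReal.rpow_natCast] at h
  simp only [Measure.smul_apply, ENNReal.smul_def, smul_eq_mul]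
  calc _ ≤ _ := mul_le_mul_right h _
    _ = _ := by ring

theorem HasThinNeighborhoods.mono_exponent {d e : ℝ} {Z : Set E} (h : HasThinNeighborhoods d Z)
    (hed : e ≤ d) : HasThinNeighborhoods e Z := by
  obtain ⟨C, ε₀, hε₀, hC⟩ := h
  refine ⟨|C|, min ε₀ 1, by positivity, fun ε h0 h1 => (hC ε h0 (h1.trans_le (min_le_left _ _))).trans ?_⟩
  refine mul_le_mul (le_abs_self C) ?_ (by positivity) (abs_nonneg C)
  exact Real.rpow_le_rpow_of_exponent_ge h0 (h1.le.trans (min_le_right _ _)) hed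

theorem HasThinNeighborhoods.mono {d : ℝ} {S T : Set E} (hT : Bornology.IsBounded T)
    (h : HasThinNeighborhoods d T) (hST : S ⊆ T) : HasThinNeighborhoods d S := by
  obtain ⟨C, ε₀, hε₀, hC⟩ := h
  exact ⟨C, ε₀, hε₀, fun ε h0 h1 => (measureReal_mono (Metric.thickening_subset_of_subset ε hST)
    hT.thickening.measure_lt_top.ne).trans (hC ε h0 h1)⟩

theorem HasThinNeighborhoods.union {d : ℝ} {S T : Set E} (hS : HasThinNeighborhoods d S)
    (hT : HasThinNeighborhoods d T) : HasThinNeighborhoods d (S ∪ T) := by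
  obtain ⟨C₁, ε₁, hε₁, hC₁⟩ := hS
  obtain ⟨C₂, ε₂, hε₂, hC₂⟩ := hT
  refine ⟨C₁ + C₂, min ε₁ ε₂, lt_min hε₁ hε₂, fun ε h0 h1 => ?_⟩
  rw [Metric.thickening_union, add_mul]
  exact (measureReal_union_le _ _).trans (add_le_add (hC₁ ε h0 (h1.trans_le (min_le_left _ _)))
    (hC₂ ε h0 (h1.trans_le (min_le_right _ _))))

theorem hasThinNeighborhoods_empty (d : ℝ) : HasThinNeighborhoods d (∅ : Set E) :=
  ⟨0, 1, one_pos, fun ε _ _ => by simp⟩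

theorem hasThinNeighborhoods_of_locally {d : ℝ} {Z : Set E} (hZ : IsCompact Z)
    (h : ∀ z ∈ Z, ∃ r > 0, HasThinNeighborhoods d (Z ∩ Metric.ball z r)) :
    HasThinNeighborhoods d Z := by
  -- Boundedness is carried along because monotonicity of `volume.real` needs finite volume.
  refine (hZ.induction_on (p := fun S => Bornology.IsBounded S ∧ HasThinNeighborhoods d S)
    ⟨Bornology.isBounded_empty, hasThinNeighborhoods_empty d⟩
    (fun S T hST hT => ⟨hT.1.subset hST, hT.2.mono hT.1 hST⟩)
    (fun S T hS hT => ⟨hS.1.union hT.1, hS.2.union hT.2⟩) fun z hz => ?_).2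
  obtain ⟨r, hr, hthin⟩ := h z hz
  exact ⟨Z ∩ Metric.ball z r, inter_mem self_mem_nhdsWithin
    (mem_nhdsWithin_of_mem_nhds (Metric.ball_mem_nhds z hr)), hZ.isBounded.subset inter_subset_left, hthin⟩

end General

variable {N : ℕ}

/-- For some d < s and all small r, Z is covered by l ≤ r^(-d) balls of radius r. Doubling the radii
covers the r-neighbourhood, of volume at most a constant times l r^N. -/
theorem hasThinNeighborhoods_of_upperMinkowskiDim_lt {Z : Set (EuclideanSpace ℝ (Fin N))} {s : ℝ}
    (h : upperMinkowskiDim Z < ENNReal.ofReal s) : HasThinNeighborhoods ((N : ℝ) - s) Z := by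
  obtain ⟨d, h⟩ := iInf_lt_iff.1 h
  obtain ⟨⟨hd0, hd⟩, hds⟩ := iInf_lt_iff.1 h
  have hds' : d < s := (ENNReal.ofReal_lt_ofReal_iff'.1 hds).1
  have hev : ∀ᶠ r : ℝ in 𝓝[>] 0, minkowskiContent d r Z < 1 :=
    eventually_lt_of_limsup_lt (by rw [hd]; exact one_pos)
  obtain ⟨ε₀, hε₀, hsub⟩ := mem_nhdsGT_iff_exists_Ioo_subset.1 hev
  set V := volume.real (Metric.ball (0 : EuclideanSpace ℝ (Fin N)) 1)
  refine HasThinNeighborhoods.mono_exponent (d := (N : ℝ) - d) ?_ (by linarith)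
  refine ⟨2 ^ N * V, ε₀, hε₀, fun r hr0 hr1 => ?_⟩
  have hr : minkowskiContent d r Z < 1 := hsub ⟨hr0, hr1⟩
  obtain ⟨l, hl⟩ := iInf_lt_iff.1 hr
  obtain ⟨x, hx⟩ := iInf_lt_iff.1 hl
  obtain ⟨⟨hxZ, hcov⟩, hlr⟩ := iInf_lt_iff.1 hx
  have hlr' : (l : ℝ) * r ^ d ≤ 1 := by
    have h1 : ENNReal.ofReal ((l : ℝ) * r ^ d) ≤ 1 := by
      rw [ENNReal.ofReal_mul (by positivity), ENNReal.ofReal_natCast]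
      exact hlr.le
    exact ENNReal.ofReal_le_one.1 h1
  have hthick : Metric.thickening r Z ⊆ ⋃ k, Metric.ball (x k) (2 * r) := by
    intro y hy
    obtain ⟨z, hz, hyz⟩ := Metric.mem_thickening_iff.1 hy
    obtain ⟨k, hk⟩ := mem_iUnion.1 (hcov hz)
    refine mem_iUnion.2 ⟨k, Metric.mem_ball.2 ?_⟩
    linarith [dist_triangle y z (x k), Metric.mem_ball.1 hk]
  have hfin : volume (⋃ k, Metric.ball (x k) (2 * r)) ≠ ⊤ :=
    ((measure_iUnion_le _).trans_lt (by
      rw [tsum_fintype]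
      exact ENNReal.sum_lt_top.2 fun k _ => measure_ball_lt_top)).ne
  have hball (y : EuclideanSpace ℝ (Fin N)) :
      volume.real (Metric.ball y (2 * r)) = (2 * r) ^ N * V := by
    rw [Measure.real, Measure.addHaar_ball_of_pos _ _ (by positivity), ENNReal.toReal_mul,
      ENNReal.toReal_ofReal (by positivity), finrank_euclideanSpace_fin]
    rfl
  calc volume.real (Metric.thickening r Z) ≤ volume.real (⋃ k, Metric.ball (x k) (2 * r)) :=
        measureReal_mono hthick hfin
    _ ≤ ∑ k, volume.real (Metric.ball (x k) (2 * r)) := measureReal_iUnion_fintype_le _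
    _ = l * ((2 * r) ^ N * V) := by
        simp [hball]
    _ = (l * r ^ d) * (2 ^ N * V * r ^ ((N : ℝ) - d)) := by
        rw [Real.rpow_sub hr0, Real.rpow_natCast, mul_pow]
        have : r ^ d ≠ 0 := (Real.rpow_pos_of_pos hr0 d).ne'
        field_simp
    _ ≤ 2 ^ N * V * r ^ ((N : ℝ) - d) := mul_le_of_le_one_left (by positivity) hlr'

theorem volume_box_eq {k : ℕ} (hk : k ≤ N) (c : Fin N → ℝ) {a M : ℝ} (ha : 0 ≤ a) (hM : 0 ≤ M) :
    volume {w : EuclideanSpace ℝ (Fin N) | ∀ i : Fin N,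
      w i ∈ Icc (c i - if k ≤ (i : ℕ) then a else M) (c i + if k ≤ (i : ℕ) then a else M)} =
      ENNReal.ofReal ((2 * a) ^ (N - k) * (2 * M) ^ k) := by
  have h1 : {w : EuclideanSpace ℝ (Fin N) | ∀ i : Fin N,
      w i ∈ Icc (c i - if k ≤ (i : ℕ) then a else M) (c i + if k ≤ (i : ℕ) then a else M)} =
      WithLp.ofLp ⁻¹' (Set.pi univ fun i : Fin N =>
        Icc (c i - if k ≤ (i : ℕ) then a else M) (c i + if k ≤ (i : ℕ) then a else M)) := by
    ext w
    simp only [mem_ofPred_eq, mem_preimage, mem_univ_pi]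
  rw [h1, (PiLp.volume_preserving_ofLp (Fin N)).measure_preimage
    (MeasurableSet.univ_pi fun i => measurableSet_Icc).nullMeasurableSet, volume_pi_pi]
  simp only [Real.volume_Icc]
  rw [← ENNReal.ofReal_prod_of_nonneg fun i _ => by split_ifs <;> linarith]
  congr 1
  have h2 (i : Fin N) : (c i + if k ≤ (i : ℕ) then a else M) - (c i - if k ≤ (i : ℕ) then a else M) =
      if (i : ℕ) < k then 2 * M else 2 * a := by
    by_cases h : k ≤ (i : ℕ)
    · simp only [h, if_true, not_lt.2 h, if_false]; ring
    · simp only [h, if_false, not_le.1 h, if_true]; ring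
  simp only [h2]
  rw [Finset.prod_ite, Finset.prod_const, Finset.prod_const]
  have h3 : (Finset.univ.filter fun i : Fin N => (i : ℕ) < k).card = k := by
    rw [Fin.card_filter_val_lt, min_eq_right hk]
  have h4 : (Finset.univ.filter fun i : Fin N => ¬ (i : ℕ) < k).card = N - k := by
    have := Finset.card_filter_add_card_filter_not (s := Finset.univ) (fun i : Fin N => (i : ℕ) < k)
    rw [h3, Finset.card_univ, Fintype.card_fin] at this
    omega
  rw [h3, h4, mul_comm]

/-- Locally, a chart sends the ε-neighbourhood into a box with N - k sides of length O(ε) and k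
bounded sides; the inverse chart is Lipschitz, so volumes grow by a bounded factor. Compactness
makes this global. -/
theorem IsClosedSmoothSubmanifold.hasThinNeighborhoods {k : ℕ}
    {Z : Set (EuclideanSpace ℝ (Fin N))} (hZ : IsClosedSmoothSubmanifold k Z) :
    HasThinNeighborhoods ((N : ℝ) - k) Z := by
  obtain ⟨hk, hZc, hchart⟩ := hZ
  refine hasThinNeighborhoods_of_locally hZc fun z hz => ?_
  obtain ⟨Φ, hzΦ, hΦ, hΦs, hΦZ⟩ := hchart z hz
  obtain ⟨K₁, t₁, ht₁, hK₁⟩ := ((hΦ.contDiffAt (Φ.open_source.mem_nhds hzΦ)).of_le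
    (by simp)).exists_lipschitzOnWith
  obtain ⟨K₂, t₂, ht₂, hK₂⟩ := ((hΦs.contDiffAt (Φ.open_target.mem_nhds (Φ.map_source hzΦ))).of_le
    (by simp)).exists_lipschitzOnWith
  have hmem : Φ.source ∩ (t₁ ∩ Φ ⁻¹' t₂) ∈ 𝓝 z := inter_mem (Φ.open_source.mem_nhds hzΦ)
    (inter_mem ht₁ ((Φ.continuousAt hzΦ).preimage_mem_nhds ht₂))
  obtain ⟨ρ, hρ, hball⟩ := Metric.mem_nhds_iff.1 hmem
  -- With ε < r, points within ε of the r-ball remain in the ρ-ball, where both Lipschitz bounds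
  -- apply.
  set r := ρ / 2
  have hr : 0 < r := by positivity
  set M : ℝ := K₁ * ρ
  have hM : 0 ≤ M := by positivity
  refine ⟨r, hr, (K₂ : ℝ) ^ N * ((2 * K₁) ^ (N - k) * (2 * M) ^ k), r, hr, fun ε hε0 hε1 => ?_⟩
  set c : Fin N → ℝ := fun i => if k ≤ (i : ℕ) then 0 else Φ z i
  set A : Set (EuclideanSpace ℝ (Fin N)) := {w | ∀ i : Fin N,
    w i ∈ Icc (c i - if k ≤ (i : ℕ) then K₁ * ε else M) (c i + if k ≤ (i : ℕ) then K₁ * ε else M)}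
  have hA := volume_box_eq hk c (by positivity : 0 ≤ K₁ * ε) hM
  have hcoord (v w : EuclideanSpace ℝ (Fin N)) (i : Fin N) : |v i - w i| ≤ dist v w := by
    rw [dist_eq_norm, ← Real.norm_eq_abs]
    exact PiLp.norm_apply_le (v - w) i
  have hsub : Metric.thickening ε (Z ∩ Metric.ball z r) ⊆ Φ.symm '' (A ∩ t₂) := by
    intro y hy
    obtain ⟨z', ⟨hz'Z, hz'r⟩, hyz'⟩ := Metric.mem_thickening_iff.1 hy
    have hz'ρ : z' ∈ Metric.ball z ρ := Metric.ball_subset_ball (by simp only [r]; linarith) hz'r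
    have hyρ : y ∈ Metric.ball z ρ := by
      rw [Metric.mem_ball] at hz'r ⊢
      have := dist_triangle y z' z
      simp only [r] at hε1 hz'r
      linarith
    obtain ⟨hys, hy1, hy2⟩ := hball hyρ
    obtain ⟨hz's, hz'1, -⟩ := hball hz'ρ
    refine ⟨Φ y, ⟨fun i => ?_, hy2⟩, Φ.left_inv hys⟩
    by_cases hi : k ≤ (i : ℕ)
    · simp only [c, hi, if_true]
      have h1 := (hcoord (Φ y) (Φ z') i).trans (hK₁.dist_le_mul y hy1 z' hz'1)
      rw [(hΦZ z' hz's).1 hz'Z i hi, sub_zero] at h1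
      have h2 : (K₁ : ℝ) * dist y z' ≤ K₁ * ε := by gcongr
      have := abs_le.1 (h1.trans h2)
      constructor <;> linarith [this.1, this.2]
    · simp only [c, hi, if_false]
      have h1 := (hcoord (Φ y) (Φ z) i).trans
        (hK₁.dist_le_mul y hy1 z (hball (Metric.mem_ball_self hρ)).2.1)
      have h2 : (K₁ : ℝ) * dist y z ≤ M := by
        have := (Metric.mem_ball.1 hyρ).le
        simp only [M]; gcongr
      have := abs_le.1 (h1.trans h2)
      constructor <;> linarith [this.1, this.2]
  have hvol : volume (Metric.thickening ε (Z ∩ Metric.ball z r)) ≤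
      ENNReal.ofReal ((K₂ : ℝ) ^ N * ((2 * (K₁ * ε)) ^ (N - k) * (2 * M) ^ k)) := by
    have h1 := (hK₂.mono (inter_subset_right : A ∩ t₂ ⊆ t₂)).volume_image_le
    rw [finrank_euclideanSpace_fin] at h1
    refine (measure_mono hsub).trans (h1.trans ?_)
    rw [ENNReal.ofReal_mul (by positivity), ← hA, ENNReal.ofReal_pow (by positivity),
      ENNReal.ofReal_coe_nnreal]
    gcongr
    exact inter_subset_left
  have h2 := ENNReal.toReal_mono ENNReal.ofReal_ne_top hvol
  rw [ENNReal.toReal_ofReal (by positivity)] at h2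
  refine h2.trans_eq ?_
  rw [← Nat.cast_sub hk, Real.rpow_natCast]
  ring

end ThinNeighborhoods

/-! ### The constant and the conclusion -/

/-- With s = (N - 4)/2 = -b, the product of the four factors in b is s(s+1)(s+2)(s+3) = Γ(s+4)/Γ(s),
which cancels the Γ(4 - b) of the bubble integral. -/
theorem rieszConst_mul {N : ℕ} (hN : 5 ≤ N) {b : ℝ} (hb : 2 * b = 4 - (N : ℝ)) :
    rieszConst N * (16 * (b * (b - 1) * (b - 2) * (b - 3)) *
      ∫ w : EuclideanSpace ℝ (Fin N), (1 + ‖w‖ ^ 2) ^ (-(4 - b))) = 1 := by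
  have hN5 : (5 : ℝ) ≤ N := by exact_mod_cast hN
  set s : ℝ := ((N : ℝ) - 4) / 2 with hs
  have hs0 : 0 < s := by rw [hs]; linarith
  have hbs : b = -s := by rw [hs]; linarith
  have hNs : (N : ℝ) / 2 = s + 2 := by rw [hs]; ring
  rw [integral_one_add_norm_sq_rpow_neg (by rw [finrank_euclideanSpace_fin, hNs]; linarith),
    finrank_euclideanSpace_fin, rieszConst, ← hs, hNs, hbs]
  have hΓ : Real.Gamma (4 - -s) = (s + 3) * ((s + 2) * ((s + 1) * (s * Real.Gamma s))) := by
    rw [← Real.Gamma_add_one hs0.ne', ← Real.Gamma_add_one (by linarith : s + 1 ≠ 0),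
      show s + 1 + 1 = s + 2 by ring, ← Real.Gamma_add_one (by linarith : s + 2 ≠ 0),
      show s + 2 + 1 = s + 3 by ring, ← Real.Gamma_add_one (by linarith : s + 3 ≠ 0)]
    congr 1; ring
  rw [hΓ, show 4 - -s - (s + 2) = 2 by ring]
  have h1 := Real.Gamma_pos_of_pos hs0
  have h2 := Real.Gamma_pos_of_pos (zero_lt_two : (0 : ℝ) < 2)
  have h3 : 0 < Real.pi ^ (s + 2) := Real.rpow_pos_of_pos Real.pi_pos _
  have h4 : s + 1 ≠ 0 := by linarith
  have h5 : s + 2 ≠ 0 := by linarith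
  have h6 : s + 3 ≠ 0 := by linarith
  field_simp
  ring

/-- The values of u on Z are arbitrary; setting them to 0 secures measurability and nonnegativity
everywhere. -/
theorem IsPositivePuncturedSolution.indicator {N : ℕ} {p : ℝ}
    {Z : Set (EuclideanSpace ℝ (Fin N))} {u : EuclideanSpace ℝ (Fin N) → ℝ} (hZ : IsClosed Z)
    (hu : IsPositivePuncturedSolution p Z u) : IsNonnegPuncturedSolution p Z (Zᶜ.indicator u) := by
  have heq : EqOn (Zᶜ.indicator u) u Zᶜ := fun x hx => indicator_of_mem hx u
  refine ⟨fun x => indicator_nonneg (fun y hy => (hu.pos y hy).le) x, ?_,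
    hu.contDiffOn.congr heq, fun x hx => ?_⟩
  · classical
    rw [← piecewise_eq_indicator]
    exact hu.contDiffOn.continuousOn.measurable_piecewise continuousOn_const
      hZ.isOpen_compl.measurableSet
  · rw [bilaplacian_congr (heq.eventuallyEq_of_mem (hZ.isOpen_compl.mem_nhds hx)), heq hx]
    exact hu.eqn x hx

theorem theorem3p4 (N : ℕ) (hN : 5 ≤ N) (p : ℝ) (hp : (N : ℝ) / ((N : ℝ) - 4) < p)
    (Z : Set (EuclideanSpace ℝ (Fin N)))
    (hZ : (IsCompact Z ∧ (∀ x ∈ Z, x ⟨0, by omega⟩ = 0) ∧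
            upperMinkowskiDim Z < ENNReal.ofReal ((N : ℝ) - 4 * p / (p - 1))) ∨
          (∃ k : ℕ, IsClosedSmoothSubmanifold k Z ∧ (k : ℝ) ≤ (N : ℝ) - 4 * p / (p - 1)))
    (u : EuclideanSpace ℝ (Fin N) → ℝ) (hu : IsPositivePuncturedSolution p Z u) :
    ∀ x ∈ Zᶜ,
      Integrable (fun y : EuclideanSpace ℝ (Fin N) => u y ^ p / ‖x - y‖ ^ ((N : ℝ) - 4)) volume ∧
      u x = rieszConst N *
        ∫ y : EuclideanSpace ℝ (Fin N), u y ^ p / ‖x - y‖ ^ ((N : ℝ) - 4) ∂volume := by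
  intro x hx
  have hN5 : (5 : ℝ) ≤ N := by exact_mod_cast hN
  have hp1 : 1 < p := lt_of_le_of_lt ((one_le_div (by linarith)).2 (by linarith)) hp
  set q : ℝ := p / (p - 1) with hq
  have hpq : p.HolderConjugate q := (Real.holderConjugate_iff_eq_conjExponent hp1).2 rfl
  have h4q : 4 * p / (p - 1) = 4 * q := by rw [hq]; ring
  rw [h4q] at hZ
  obtain ⟨hZc, hthin⟩ : IsCompact Z ∧ HasThinNeighborhoods (4 * q) Z := by
    rcases hZ with ⟨hZc, -, hdim⟩ | ⟨k, hZk, hk⟩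
    · have := hasThinNeighborhoods_of_upperMinkowskiDim_lt hdim
      rw [sub_sub_cancel] at this
      exact ⟨hZc, this⟩
    · exact ⟨hZk.2.1, hZk.hasThinNeighborhoods.mono_exponent (by linarith)⟩
  have hv := hu.indicator hZc.isClosed
  set v := Zᶜ.indicator u
  set b : ℝ := (4 - (N : ℝ)) / 2 with hb
  have hb2 : 2 * b = 4 - (N : ℝ) := by rw [hb]; ring
  obtain ⟨hint, heq⟩ := hv.integrable_riesz hpq hZc hthin
    (by rw [finrank_euclideanSpace_fin]; exact hb2) (by rw [hb]; linarith) hx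
  -- Since Z is a null set, the change of u on Z does not affect the integral.
  have hae : (fun y => v y ^ p * (‖y - x‖ ^ 2) ^ b) =ᵐ[volume]
      fun y => u y ^ p / ‖x - y‖ ^ ((N : ℝ) - 4) := by
    filter_upwards [measure_eq_zero_iff_ae_notMem.1
      (hthin.measure_zero hZc (by linarith [hpq.symm.pos]))] with y hy
    have h1 : v y = u y := indicator_of_mem hy u
    rw [h1, div_eq_mul_inv, ← Real.rpow_neg (norm_nonneg _), ← Real.rpow_natCast,
      ← Real.rpow_mul (norm_nonneg _), norm_sub_rev]
    congr 2
    push_cast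
    linarith
  refine ⟨hint.congr hae, ?_⟩
  rw [← integral_congr_ae hae, heq, ← mul_assoc, rieszConst_mul hN hb2, one_mul]
  exact (indicator_of_mem hx u).symm
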